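/- Let $\mathbb K$ be $\mathbb R$ or $\mathbb C$, let $(E_n)$ be a sequence of finite dimensional normed spaces over $\mathbb K$, infinitely many of which are non-zero, and let $E=(\bigoplus_n E_n)_{\ell_2}$ be their $\ell_2$-sum, $\|x\|^2=\sum_n\|x_n\|_{E_n}^2$. Assume that for some sequence of exponents $1\le p_n<2$ with $p_n\to 2$ the following conditions hold: (a) for every $n$ and all $x,y\in E_n$, $$\|x+y\|^2+\|x-y\|^2\le 2\left(\|x\|^{p_n}+\|y\|^{p_n}\right)^{2/p_n};$$ (b) for every $n$ there is a basis $\mathcal B_n$ of $E_n$ such that for every $y\in\mathcal B_n$ there is $x\in\mathcal B_n$ such that $(x,y)$ is an $\ell_{p_n}$-pair, that is, $\|x+\lambda y\|^{p_n}=1+|\lambda|^{p_n}$ for every $\lambda\in\mathbb R$. Then: (1) $E$, equipped with the convex modular $\Theta(x)=\|x\|^2$, is an infinite dimensional modular Banach space satisfying the $\Delta_2$ condition ($\Theta(2x)\le C\,\Theta(x)$ for some constant $C$ and all $x$), whose norm is the Luxemburg norm $\inf\{t>0:\Theta(x/t)\le1\}$ of $\Theta$, such that: (i) every ultrapower $E_{\mathcal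 U}$, equipped with the modular $\Theta_{\mathcal U}([x_i])=\lim_{\mathcal U}\Theta(x_i)$, is the image of a modular direct sum $E\oplus_m H$, for some Hilbert space $H$, under a modular preserving linear bijection; (ii) for every Hilbert space $H$, every linear isometric operator $E\to E\oplus_m H$ maps $E$ onto $E$. Here $E\oplus_m H$ is $E\times H$ with the modular $\Theta(x)+\|h\|^2$ and the associated Luxemburg norm, which for this $\Theta$ is the norm of the 2-sum. (2) $E$ is uncountably categorical: for some uncountable cardinal $\kappa$ there is, up to linear isometry, exactly one Banach space of density character $\kappa$ (the least cardinality of a dense subset) in the elementary class of $E$, that is, among the Banach spaces $X$ over $\mathbb K$ such that some ultrapower of $X$ is linearly isometric to some ultrapower of $E$. -/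

import Mathlib

open Filter Topology
open scoped ENNReal Cardinal

universe u

noncomputable section

/-! ### Modulars -/

/-- A (finite) convex modular on a vector space `X` over `𝕜 = ℝ` or `ℂ`. -/
structure IsConvexModular (𝕜 : Type*) [RCLike 𝕜] {X : Type*} [AddCommGroup X] [Module 𝕜 X]
    (Θ : X → ℝ) : Prop where
  nonneg : ∀ x, 0 ≤ Θ x
  convex : ∀ x y : X, ∀ a b : ℝ, 0 ≤ a → 0 ≤ b → a + b = 1 →
    Θ ((a : 𝕜) • x + (b : 𝕜) • y) ≤ a * Θ x + b * Θ y
  map_zero : Θ 0 = 0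
  symmetric : ∀ (c : 𝕜) (x : X), ‖c‖ = 1 → Θ (c • x) = Θ x
  faithful : ∀ x, Θ x = 0 → x = 0

/-- The Luxemburg norm `inf {t > 0 : Θ (x / t) ≤ 1}` of a modular `Θ`. -/
def luxemburgNorm (𝕜 : Type*) [RCLike 𝕜] {X : Type*} [AddCommGroup X] [Module 𝕜 X]
    (Θ : X → ℝ) (x : X) : ℝ :=
  sInf {t : ℝ | 0 < t ∧ Θ (((t : 𝕜)⁻¹) • x) ≤ 1}

/-- The `Δ₂` condition: `Θ (2x) ≤ C Θ (x)` for some constant `C`. -/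
def SatisfiesDeltaTwo (𝕜 : Type*) [RCLike 𝕜] {X : Type*} [AddCommGroup X] [Module 𝕜 X]
    (Θ : X → ℝ) : Prop :=
  ∃ C : ℝ, ∀ x : X, Θ ((2 : 𝕜) • x) ≤ C * Θ x

/-- The modular of the modular direct sum `X ⊕ₘ H` (carried by `X × H`) of a modular space
`(X, Θ)` and a Hilbert space `H`, the latter being equipped with the modular `h ↦ ‖h‖²`. -/
def modularSum {X H : Type*} [NormedAddCommGroup H] (Θ : X → ℝ) (z : X × H) : ℝ :=
  Θ z.1 + ‖z.2‖ ^ 2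

/-! ### Ultrapowers of Banach spaces -/

/-- The subspace of `ℓ_∞(I, X)` of the families whose norms tend to `0` along `U`. -/
def ultraNull (𝕜 : Type*) [RCLike 𝕜] {I : Type*} (U : Ultrafilter I) (X : Type*)
    [NormedAddCommGroup X] [NormedSpace 𝕜 X] : Submodule 𝕜 (lp (fun _ : I => X) ∞) where
  carrier := {x | Tendsto (fun i => ‖x i‖) (U : Filter I) (𝓝 0)}
  zero_mem' := by simp
  add_mem' := by
    intro x y hx hy
    have hxy := Filter.Tendsto.add hx hy
    rw [add_zero] at hxy
    refine squeeze_zero (fun _ => norm_nonneg _) (fun i => ?_) hxy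
    simpa using norm_add_le (x i) (y i)
  smul_mem' := by
    intro c x hx
    have h := Filter.Tendsto.const_mul ‖c‖ hx
    simpa [norm_smul] using h

/-- The Banach space ultrapower `X_U = ℓ_∞(I, X) / {x : lim_U ‖x i‖ = 0}`, with the quotient
norm (which is `‖[x]‖ = lim_U ‖x i‖`). -/
abbrev BanachUltrapower (𝕜 : Type*) [RCLike 𝕜] {I : Type*} (U : Ultrafilter I) (X : Type*)
    [NormedAddCommGroup X] [NormedSpace 𝕜 X] :=
  lp (fun _ : I => X) ∞ ⧸ ultraNull 𝕜 U X

/-- The class `[x i]_U` of a bounded family in the ultrapower. -/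
def ultraMk (𝕜 : Type*) [RCLike 𝕜] {I : Type*} (U : Ultrafilter I) {X : Type*}
    [NormedAddCommGroup X] [NormedSpace 𝕜 X] (x : lp (fun _ : I => X) ∞) :
    BanachUltrapower 𝕜 U X :=
  Submodule.Quotient.mk x

/-! ### Elementary equivalence and categoricity -/

/-- Two Banach spaces are elementarily equivalent if some ultrapower of the one is linearly
isometric to some ultrapower of the other. The elementary class of `X` consists of the Banach
spaces that are elementarily equivalent to `X`. -/
def ElementarilyEquivalent (𝕜 : Type*) [RCLike 𝕜] (X Y : Type u)
    [NormedAddCommGroup X] [NormedSpace 𝕜 X] [NormedAddCommGroup Y] [NormedSpace 𝕜 Y] : Prop :=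
  ∃ (I J : Type u) (U : Ultrafilter I) (V : Ultrafilter J),
    Nonempty (BanachUltrapower 𝕜 U X ≃ₗᵢ[𝕜] BanachUltrapower 𝕜 V Y)

/-- The density character: the least cardinality of a dense subset. -/
def densityCharacter (X : Type u) [TopologicalSpace X] : Cardinal.{u} :=
  sInf {c | ∃ s : Set X, Dense s ∧ #s = c}

/-- `X` is `κ`-categorical: up to linear isometry, its elementary class contains exactly one
Banach space of density character `κ`. -/
def IsCardinalCategorical (𝕜 : Type*) [RCLike 𝕜] (X : Type u)
    [NormedAddCommGroup X] [NormedSpace 𝕜 X] (κ : Cardinal.{u}) : Prop :=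
  (∃ (Y : Type u) (_ : NormedAddCommGroup Y) (_ : NormedSpace 𝕜 Y),
    CompleteSpace Y ∧ ElementarilyEquivalent 𝕜 X Y ∧ densityCharacter Y = κ) ∧
  ∀ (Y Z : Type u) [NormedAddCommGroup Y] [NormedSpace 𝕜 Y] [CompleteSpace Y]
    [NormedAddCommGroup Z] [NormedSpace 𝕜 Z] [CompleteSpace Z],
    ElementarilyEquivalent 𝕜 X Y → densityCharacter Y = κ →
    ElementarilyEquivalent 𝕜 X Z → densityCharacter Z = κ →
    Nonempty (Y ≃ₗᵢ[𝕜] Z)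

/-- An (infinite dimensional) Banach space is uncountably categorical if it is `κ`-categorical
for some uncountable cardinal `κ`. -/
def UncountablyCategorical (𝕜 : Type*) [RCLike 𝕜] (X : Type u)
    [NormedAddCommGroup X] [NormedSpace 𝕜 X] : Prop :=
  ¬ FiniteDimensional 𝕜 X ∧ CompleteSpace X ∧
    ∃ κ : Cardinal.{u}, ℵ₀ < κ ∧ IsCardinalCategorical 𝕜 X κ

/-- The hypotheses of the categoricity criterion for a space `E` with a modular `Θ`: `E` is an
infinite dimensional `Δ₂` modular Banach space such that
(i) every ultrapower `E_U`, with the modular `Θ_U [x i] = lim_U Θ (x i)`, is linearly isomodular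
to `E ⊕ₘ H` for some Hilbert space `H`;
(ii) every linear isometric operator `E → E ⊕ₘ H`, with `H` any Hilbert space, maps `E` onto
`E` (that is, onto `E × {0}`). -/
structure CategoricityCriterion (𝕜 : Type*) [RCLike 𝕜] (E : Type u)
    [NormedAddCommGroup E] [NormedSpace 𝕜 E] (Θ : E → ℝ) : Prop where
  isConvexModular : IsConvexModular 𝕜 Θ
  norm_eq_luxemburgNorm : ∀ x : E, ‖x‖ = luxemburgNorm 𝕜 Θ x
  deltaTwo : SatisfiesDeltaTwo 𝕜 Θ
  complete : CompleteSpace E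
  infiniteDimensional : ¬ FiniteDimensional 𝕜 E
  ultrapower_isomodular : ∀ (I : Type u) (U : Ultrafilter I),
    ∃ (H : Type u) (_ : NormedAddCommGroup H) (_ : InnerProductSpace 𝕜 H) (_ : CompleteSpace H)
      (Φ : BanachUltrapower 𝕜 U E ≃ₗ[𝕜] E × H),
      ∀ x : lp (fun _ : I => E) ∞,
        Tendsto (fun i => Θ (x i)) (U : Filter I) (𝓝 (modularSum Θ (Φ (ultraMk 𝕜 U x))))
  isometry_onto : ∀ (H : Type u) [NormedAddCommGroup H] [InnerProductSpace 𝕜 H]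
    [CompleteSpace H] (T : E →ₗ[𝕜] E × H),
    (∀ x : E, luxemburgNorm 𝕜 (modularSum Θ : E × H → ℝ) (T x) = ‖x‖) →
      Set.range T = {z : E × H | z.2 = 0}

/-- `(x, y)` is an `ℓ_p`-pair: `‖x + t y‖ ^ p = 1 + |t| ^ p` for all real `t`. -/
def IsEllPair (𝕜 : Type*) [RCLike 𝕜] {X : Type*} [NormedAddCommGroup X] [NormedSpace 𝕜 X]
    (p : ℝ) (x y : X) : Prop :=
  ∀ t : ℝ, ‖x + (t : 𝕜) • y‖ ^ p = 1 + |t| ^ p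

end

/-! Write `E = lp G 2`, and call a space a Hilbert extension of `E` if it is a 2-sum `E ⊕ H` with
`H` Hilbert. Everything rests on two facts.

Stability (`IsHilbertExtension.ultrapower`): ultrapowers of complete Hilbert extensions are Hilbert
extensions. Taking coordinatewise limits along the ultrafilter retracts the ultrapower onto `E`, the
limits existing because each coordinate space is finite dimensional. A family in the kernel has
coordinates tending to zero. It is 2-orthogonal to `E`, since a finitely supported vector meets only
finitely many of its coordinates. On the remaining coordinates, (a) is the parallelogram inequality
up to the factor `2 ^ (2 / p n - 1)`, which tends to 1; so the kernel is a Hilbert space by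
Jordan–von Neumann.

Rigidity (`range_eq_of_isometry`): an isometry `E → E ⊕ H` has range `E`. Process the exponents in
increasing order; only finitely many summands lie below any bound less than 2. By (a), coordinates
of larger exponent and the Hilbert part contribute only `o(t ^ c)` to the growth of an averaged
squared norm, whereas an `ℓ_c`-pair requires growth of order `t ^ c`. Hence the image of its second
vector lies in the coordinates of exponent exactly `c` (`eq_zero_of_ellPair_image`). Injectivity on
finite dimensional pieces then gives surjectivity.

For categoricity, let `Y` be elementarily equivalent to `E`. Some ultrapower of `Y` is a Hilbert
extension of `E`. It embeds in its own ultrapower in two ways, diagonally and by the ultrapower of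
the diagonal map of `Y`; rigidity makes the images of `E` coincide, which places `E` inside `Y`
(`IsHilbertExtension.of_ultrapower`). Thus `Y` is `E ⊕ H'`, and as `E` is separable, an uncountable
density character determines the Hilbert dimension of `H'`. -/

noncomputable section

/-! ### Norms and canonical maps of Banach space ultrapowers -/

section Ultrapower

theorem Ultrafilter.exists_tendsto_of_norm_le {I X : Type*} [SeminormedAddCommGroup X]
    [ProperSpace X] (U : Ultrafilter I) {f : I → X} {C : ℝ} (h : ∀ i, ‖f i‖ ≤ C) :
    ∃ a, Tendsto f (U : Filter I) (𝓝 a) := by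
  obtain ⟨a, -, ha⟩ := (isCompact_closedBall (0 : X) C).ultrafilter_le_nhds (U.map f) (by
    rw [le_principal_iff]
    exact Filter.mem_map.2 (Filter.univ_mem' fun i => by simpa using h i))
  exact ⟨a, ha⟩

variable {𝕜 : Type*} [RCLike 𝕜] {I : Type*} (U : Ultrafilter I)
  {X Y : Type*} [NormedAddCommGroup X] [NormedSpace 𝕜 X] [NormedAddCommGroup Y] [NormedSpace 𝕜 Y]

/-- A bounded family as an element of `ℓ_∞(I, X)`. -/
def boundedFamily {I X : Type*} [NormedAddCommGroup X] (w : I → X) (C : ℝ)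
    (h : ∀ i, ‖w i‖ ≤ C) : lp (fun _ : I => X) ∞ :=
  ⟨w, memℓp_infty ⟨C, by rintro _ ⟨i, rfl⟩; exact h i⟩⟩

@[simp] theorem boundedFamily_apply {I X : Type*} [NormedAddCommGroup X] (w : I → X) (C : ℝ)
    (h : ∀ i, ‖w i‖ ≤ C) (i : I) : boundedFamily w C h i = w i := rfl

theorem norm_apply_le_norm_infty {I X : Type*} [NormedAddCommGroup X]
    (x : lp (fun _ : I => X) ∞) (i : I) : ‖x i‖ ≤ ‖x‖ :=
  lp.norm_apply_le_norm ENNReal.top_ne_zero x i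

theorem mem_ultraNull {x : lp (fun _ : I => X) ∞} :
    x ∈ ultraNull 𝕜 U X ↔ Tendsto (fun i => ‖x i‖) (U : Filter I) (𝓝 0) := Iff.rfl

theorem tendsto_norm_ultraMk (x : lp (fun _ : I => X) ∞) :
    Tendsto (fun i => ‖x i‖) (U : Filter I) (𝓝 ‖ultraMk 𝕜 U x‖) := by
  obtain ⟨L, hL⟩ := U.exists_tendsto_of_norm_le (f := fun i => ‖x i‖) (C := ‖x‖)
    (fun i => by simpa using norm_apply_le_norm_infty x i)
  have hL0 : 0 ≤ L := ge_of_tendsto' hL fun i => norm_nonneg _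
  suffices h : ‖ultraMk 𝕜 U x‖ = L by rwa [h]
  apply le_antisymm
  · refine le_of_forall_pos_le_add fun ε hε => ?_
    classical
    -- Truncating the family off a set of the ultrafilter gives another representative, whose
    -- supremum norm is at most `L + ε`.
    let m : lp (fun _ : I => X) ∞ :=
      boundedFamily (fun i => if ‖x i‖ ≤ L + ε then x i else 0) (L + ε) (fun i => by
        split_ifs with h
        · exact h
        · simp; positivity)
    have hm : ultraMk 𝕜 U x = ultraMk 𝕜 U m := by
      refine (Submodule.Quotient.eq _).2 ?_
      rw [mem_ultraNull]
      refine tendsto_const_nhds.congr' ?_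
      filter_upwards [hL.eventually (gt_mem_nhds (show L < L + ε by linarith))] with i hi
      simp [m, hi.le]
    rw [hm]
    refine (Submodule.Quotient.norm_mk_le _ _).trans ?_
    refine lp.norm_le_of_forall_le (by positivity) fun i => ?_
    simp only [m, boundedFamily_apply]
    split_ifs with h
    · exact h
    · simp; positivity
  · refine le_of_forall_pos_le_add fun ε hε => ?_
    obtain ⟨m, hm, hm'⟩ := Submodule.Quotient.norm_mk_lt (S := ultraNull 𝕜 U X)
      (ultraMk 𝕜 U x) hε
    have hn : Tendsto (fun i => ‖(m - x) i‖) (U : Filter I) (𝓝 0) :=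
      (Submodule.Quotient.eq (ultraNull 𝕜 U X)).1 hm
    have := hL.sub hn
    rw [sub_zero] at this
    refine (le_of_tendsto' this fun i => ?_).trans hm'.le
    have h1 := norm_apply_le_norm_infty m i
    have h2 : ‖x i‖ - ‖m i - x i‖ ≤ ‖m i‖ := by
      linarith [norm_le_insert (m i) (x i)]
    exact h2.trans h1

theorem norm_ultraMk_eq {x : lp (fun _ : I => X) ∞} {L : ℝ}
    (h : Tendsto (fun i => ‖x i‖) (U : Filter I) (𝓝 L)) : ‖ultraMk 𝕜 U x‖ = L :=
  tendsto_nhds_unique (tendsto_norm_ultraMk U x) h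

/-- Closedness makes the quotient seminorm a norm, so that the ultrapower is a normed space. -/
instance isClosed_ultraNull : IsClosed (ultraNull 𝕜 U X : Set (lp (fun _ : I => X) ∞)) := by
  have : (ultraNull 𝕜 U X : Set (lp (fun _ : I => X) ∞)) =
      (fun x : lp (fun _ : I => X) ∞ => ‖ultraMk 𝕜 U x‖) ⁻¹' {0} := by
    ext x
    simp only [SetLike.mem_coe, mem_ultraNull, Set.mem_preimage, Set.mem_singleton_iff]
    exact ⟨norm_ultraMk_eq U, fun h => h ▸ tendsto_norm_ultraMk U x⟩
  rw [this]
  have hc : Continuous (fun x : lp (fun _ : I => X) ∞ => ultraMk 𝕜 U x) :=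
    AddMonoidHomClass.continuous_of_bound (ultraNull 𝕜 U X).mkQ 1 fun x => by
      simpa using Submodule.Quotient.norm_mk_le _ x
  exact isClosed_singleton.preimage hc.norm

theorem ultraMk_surjective (z : BanachUltrapower 𝕜 U X) : ∃ x, ultraMk 𝕜 U x = z :=
  Submodule.Quotient.mk_surjective _ z

variable (𝕜 X) in
/-- The diagonal embedding of a Banach space into its ultrapower. -/
def ultraDiag : X →ₗᵢ[𝕜] BanachUltrapower 𝕜 U X where
  toFun x := ultraMk 𝕜 U (boundedFamily (fun _ => x) ‖x‖ fun _ => le_rfl)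
  map_add' _ _ := rfl
  map_smul' _ _ := rfl
  norm_map' x := norm_ultraMk_eq U (by simp)

/-- The map induced between `ℓ_∞` spaces of families by a linear isometry. -/
def boundedFamilyMap (I : Type*) (T : X →ₗᵢ[𝕜] Y) :
    lp (fun _ : I => X) ∞ →ₗ[𝕜] lp (fun _ : I => Y) ∞ where
  toFun x := boundedFamily (fun i => T (x i)) ‖x‖ fun i => by
    simpa using norm_apply_le_norm_infty x i
  map_add' x y := by ext i; simp
  map_smul' c x := by ext i; simp

/-- The ultrapower of a linear isometry. -/
def ultraMap (T : X →ₗᵢ[𝕜] Y) : BanachUltrapower 𝕜 U X →ₗᵢ[𝕜] BanachUltrapower 𝕜 U Y where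
  toLinearMap := Submodule.mapQ _ _ (boundedFamilyMap I T) fun x hx => by
    simpa [mem_ultraNull, boundedFamilyMap] using hx
  norm_map' z := by
    obtain ⟨x, rfl⟩ := ultraMk_surjective U z
    exact norm_ultraMk_eq U (by simpa [boundedFamilyMap] using tendsto_norm_ultraMk U x)

theorem ultraMap_ultraMk (T : X →ₗᵢ[𝕜] Y) (x : lp (fun _ : I => X) ∞) :
    ultraMap U T (ultraMk 𝕜 U x) = ultraMk 𝕜 U (boundedFamilyMap I T x) := rfl

/-- Modulo a principal ultrafilter only the value at `i` matters. Thus any space is an ultrapower of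
itself, which later exhibits an ultrapower of `E` as a member of its elementary class. -/
theorem ultraDiag_surjective_of_pure (i : I) :
    Function.Surjective (ultraDiag 𝕜 (pure i : Ultrafilter I) X) := by
  intro z
  obtain ⟨x, rfl⟩ := ultraMk_surjective _ z
  refine ⟨x i, (Submodule.Quotient.eq _).2 ?_⟩
  rw [mem_ultraNull]
  refine tendsto_const_nhds.congr' ?_
  rw [Ultrafilter.coe_pure, EventuallyEq, Filter.eventually_pure]
  simp

end Ultrapower

/-! ### Finitely supported vectors in an ℓ₂-sum -/

section EllTwoSum

variable {𝕜 : Type*} [RCLike 𝕜] {G : ℕ → Type u} [∀ n, NormedAddCommGroup (G n)]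
  [∀ n, NormedSpace 𝕜 (G n)]

theorem hasSum_norm_sq (x : lp G 2) : HasSum (fun n => ‖x n‖ ^ 2) (‖x‖ ^ 2) := by
  simpa using lp.hasSum_norm (p := 2) (by simp) x

theorem norm_apply_le_norm_two (x : lp G 2) (n : ℕ) : ‖x n‖ ≤ ‖x‖ :=
  lp.norm_apply_le_norm two_ne_zero x n

theorem norm_add_sq_of_forall_notMem {f : lp G 2} {s : Finset ℕ} (hf : ∀ n ∉ s, f n = 0)
    (b : lp G 2) : ‖f + b‖ ^ 2 = ‖b‖ ^ 2 + ∑ n ∈ s, (‖f n + b n‖ ^ 2 - ‖b n‖ ^ 2) := by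
  have h1 := (hasSum_norm_sq (f + b)).sub (hasSum_norm_sq b)
  have h2 : HasSum (fun n => ‖(f + b) n‖ ^ 2 - ‖b n‖ ^ 2)
      (∑ n ∈ s, (‖f n + b n‖ ^ 2 - ‖b n‖ ^ 2)) :=
    hasSum_sum_of_ne_finset_zero fun n hn => by simp [hf n hn]
  linarith [h1.unique h2]

theorem norm_sq_eq_sum_of_forall_notMem {f : lp G 2} {s : Finset ℕ} (hf : ∀ n ∉ s, f n = 0) :
    ‖f‖ ^ 2 = ∑ n ∈ s, ‖f n‖ ^ 2 := by
  simpa using norm_add_sq_of_forall_notMem hf 0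

theorem sum_single_apply_of_notMem (f : lp G 2) {s : Finset ℕ} {n : ℕ} (hn : n ∉ s) :
    (∑ m ∈ s, lp.single 2 m (f m) : lp G 2) n = 0 := by
  rw [lp.coeFn_sum, Finset.sum_apply]
  refine Finset.sum_eq_zero fun m hm => ?_
  exact lp.single_apply_ne _ _ _ fun h => hn (h ▸ hm)

end EllTwoSum

/-! ### Hilbert extensions and their stability under ultrapowers -/

section HilbertExtension

/-- `W` is isometric to the `2`-sum of `E` and some Hilbert space. -/
def IsHilbertExtension (𝕜 : Type*) [RCLike 𝕜] (E W : Type u) [NormedAddCommGroup E]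
    [NormedSpace 𝕜 E] [NormedAddCommGroup W] [NormedSpace 𝕜 W] : Prop :=
  ∃ (H : Type u) (_ : NormedAddCommGroup H) (_ : InnerProductSpace 𝕜 H) (_ : CompleteSpace H)
    (Φ : W ≃ₗ[𝕜] E × H), ∀ w, ‖w‖ ^ 2 = ‖(Φ w).1‖ ^ 2 + ‖(Φ w).2‖ ^ 2

theorem IsHilbertExtension.refl (𝕜 : Type*) [RCLike 𝕜] (E : Type u) [NormedAddCommGroup E]
    [NormedSpace 𝕜 E] : IsHilbertExtension 𝕜 E E :=
  ⟨PUnit.{u + 1}, inferInstance, InnerProductSpace.ofNorm 𝕜 (by simp), inferInstance,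
    LinearEquiv.ofLinearMap (LinearMap.inl 𝕜 E PUnit.{u + 1}) (LinearMap.fst 𝕜 E PUnit.{u + 1})
      (by ext <;> simp) (by ext; simp), fun w => by simp⟩

variable {𝕜 : Type*} [RCLike 𝕜] {G : ℕ → Type u} [∀ n, NormedAddCommGroup (G n)]
  [∀ n, NormedSpace 𝕜 (G n)]

theorem IsHilbertExtension.congr {E W W' : Type u} [NormedAddCommGroup E]
    [NormedSpace 𝕜 E] [NormedAddCommGroup W] [NormedSpace 𝕜 W] [NormedAddCommGroup W']
    [NormedSpace 𝕜 W'] (h : IsHilbertExtension 𝕜 E W) (e : W ≃ₗᵢ[𝕜] W') :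
    IsHilbertExtension 𝕜 E W' := by
  obtain ⟨H, _, _, _, Φ, hΦ⟩ := h
  refine ⟨H, _, _, ‹_›, e.symm.toLinearEquiv.trans Φ, fun w => ?_⟩
  rw [← e.symm.norm_map w, hΦ]
  rfl

theorem complete_finiteDimensional_ellTwoSum (𝕜 : Type*) [RCLike 𝕜] (G : ℕ → Type u)
    [∀ n, NormedAddCommGroup (G n)] [∀ n, NormedSpace 𝕜 (G n)]
    [∀ n, FiniteDimensional 𝕜 (G n)] : CompleteSpace (lp G 2) := by
  have : ∀ n, CompleteSpace (G n) := fun n => FiniteDimensional.complete 𝕜 (G n)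
  infer_instance

/-- The coordinatewise limit of a contraction from `W` to an `ℓ₂`-sum along an ultrafilter. -/
theorem exists_coordinate_limit [∀ n, FiniteDimensional 𝕜 (G n)]
    {W : Type*} [NormedAddCommGroup W] [NormedSpace 𝕜 W]
    {I : Type*} (U : Ultrafilter I) (π : W →ₗ[𝕜] lp G 2) (hπ : ∀ w, ‖π w‖ ≤ ‖w‖) :
    ∃ D : BanachUltrapower 𝕜 U W →ₗ[𝕜] lp G 2, ∀ (x : lp (fun _ : I => W) ∞) (n : ℕ),
      Tendsto (fun i => π (x i) n) (U : Filter I) (𝓝 (D (ultraMk 𝕜 U x) n)) := by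
  have : ∀ n, ProperSpace (G n) := fun n => FiniteDimensional.proper_rclike 𝕜 (G n)
  have hb : ∀ (x : lp (fun _ : I => W) ∞) (i : I), ‖π (x i)‖ ≤ ‖x‖ := fun x i =>
    (hπ _).trans (norm_apply_le_norm_infty x i)
  have hex : ∀ (x : lp (fun _ : I => W) ∞) (n : ℕ),
      ∃ a, Tendsto (fun i => π (x i) n) (U : Filter I) (𝓝 a) := fun x n =>
    U.exists_tendsto_of_norm_le (C := ‖x‖) fun i => (norm_apply_le_norm_two _ n).trans (hb x i)
  choose a ha using hex
  have hmem : ∀ x, Memℓp (a x) 2 := fun x => by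
    refine memℓp_gen' (C := ‖x‖ ^ 2) fun s => ?_
    -- A Fatou argument: finite partial sums pass to the limit and keep the uniform bound.
    have h1 : Tendsto (fun i => ∑ n ∈ s, ‖π (x i) n‖ ^ 2) (U : Filter I)
        (𝓝 (∑ n ∈ s, ‖a x n‖ ^ 2)) := tendsto_finsetSum _ fun n _ => ((ha x n).norm.pow 2)
    have h2 : ∑ n ∈ s, ‖a x n‖ ^ 2 ≤ ‖x‖ ^ 2 := le_of_tendsto' h1 fun i =>
      (sum_le_hasSum s (fun _ _ => by positivity) (hasSum_norm_sq _)).trans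
        (pow_le_pow_left₀ (norm_nonneg _) (hb x i) 2)
    simpa using h2
  let D₀ : lp (fun _ : I => W) ∞ →ₗ[𝕜] lp G 2 :=
    { toFun := fun x => ⟨a x, hmem x⟩
      map_add' := fun x y => by
        ext n
        refine tendsto_nhds_unique (ha (x + y) n) ?_
        change Tendsto _ _ (𝓝 (a x n + a y n))
        simpa using (ha x n).add (ha y n)
      map_smul' := fun c x => by
        ext n
        refine tendsto_nhds_unique (ha (c • x) n) ?_
        change Tendsto _ _ (𝓝 (c • a x n))
        simpa using (ha x n).const_smul c }
  refine ⟨(ultraNull 𝕜 U W).liftQ D₀ fun x hx => ?_, fun x n => ha x n⟩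
  rw [LinearMap.mem_ker]
  ext n
  refine tendsto_nhds_unique (ha x n) ?_
  refine squeeze_zero_norm (fun i => ?_) hx
  exact (norm_apply_le_norm_two _ n).trans (hπ _)

/-- Families with vanishing coordinates are orthogonal to the `ℓ₂`-sum. -/
theorem norm_ultraDiag_add_sq {W : Type*} [NormedAddCommGroup W] [NormedSpace 𝕜 W]
    {I : Type*} (U : Ultrafilter I) (π : W →ₗ[𝕜] lp G 2) (σ : lp G 2 →ₗᵢ[𝕜] W)
    (hσ : ∀ f w, ‖σ f + w‖ ^ 2 = ‖w‖ ^ 2 + (‖f + π w‖ ^ 2 - ‖π w‖ ^ 2))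
    (x : lp (fun _ : I => W) ∞)
    (hx : ∀ n, Tendsto (fun i => π (x i) n) (U : Filter I) (𝓝 0)) (f : lp G 2) :
    ‖ultraDiag 𝕜 U W (σ f) + ultraMk 𝕜 U x‖ ^ 2 = ‖f‖ ^ 2 + ‖ultraMk 𝕜 U x‖ ^ 2 := by
  -- For finite support, `hσ` leaves a finite correction sum, whose limit is computed termwise from
  -- `hx`; the general case follows by density and continuity.
  have key : ∀ (s : Finset ℕ) (g : lp G 2), (∀ n ∉ s, g n = 0) →
      ‖ultraDiag 𝕜 U W (σ g) + ultraMk 𝕜 U x‖ ^ 2 = ‖g‖ ^ 2 + ‖ultraMk 𝕜 U x‖ ^ 2 := by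
    intro s g hg
    have h1 : Tendsto (fun i => ‖σ g + x i‖ ^ 2) (U : Filter I)
        (𝓝 (‖ultraDiag 𝕜 U W (σ g) + ultraMk 𝕜 U x‖ ^ 2)) :=
      (tendsto_norm_ultraMk U
        (boundedFamily (fun _ : I => σ g) ‖σ g‖ (fun _ => le_rfl) + x)).pow 2
    have h2 : Tendsto (fun i => ‖x i‖ ^ 2 + ∑ n ∈ s, (‖g n + π (x i) n‖ ^ 2 - ‖π (x i) n‖ ^ 2))
        (U : Filter I) (𝓝 (‖ultraMk 𝕜 U x‖ ^ 2 + ∑ n ∈ s, (‖g n + 0‖ ^ 2 - ‖(0 : G n)‖ ^ 2))) :=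
      ((tendsto_norm_ultraMk U x).pow 2).add (tendsto_finsetSum _ fun n _ =>
        (((hx n).const_add (g n)).norm.pow 2).sub ((hx n).norm.pow 2))
    have h3 := tendsto_nhds_unique h1 (h2.congr fun i => by
      rw [hσ, norm_add_sq_of_forall_notMem hg (π (x i))]; ring)
    rw [h3, norm_sq_eq_sum_of_forall_notMem hg]
    simp [add_comm]
  have hf : Tendsto (fun s : Finset ℕ => ∑ m ∈ s, lp.single 2 m (f m)) atTop (𝓝 f) :=
    lp.hasSum_single (p := 2) ENNReal.ofNat_ne_top f
  have hc1 : Continuous fun g : lp G 2 =>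
      ‖ultraDiag 𝕜 U W (σ g) + ultraMk 𝕜 U x‖ ^ 2 :=
    ((((ultraDiag 𝕜 U W).continuous.comp σ.continuous).add continuous_const).norm.pow 2)
  have hc2 : Continuous fun g : lp G 2 => ‖g‖ ^ 2 + ‖ultraMk 𝕜 U x‖ ^ 2 := by fun_prop
  refine tendsto_nhds_unique ((hc1.tendsto f).comp hf) (((hc2.tendsto f).comp hf).congr ?_)
  exact fun s => (key s _ fun n hn => sum_single_apply_of_notMem f hn).symm

/-- Convexity of `u ↦ u ^ (2 / p)`. The constant tends to 1 as `p → 2`. -/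
theorem rpow_add_rpow_two_div_le {p s t : ℝ} (hp : 0 < p) (hp2 : p ≤ 2) (hs : 0 ≤ s)
    (ht : 0 ≤ t) : (s ^ p + t ^ p) ^ (2 / p) ≤ 2 ^ (2 / p - 1) * (s ^ 2 + t ^ 2) := by
  have h := NNReal.rpow_add_le_mul_rpow_add_rpow (s ^ p).toNNReal (t ^ p).toNNReal
    (p := 2 / p) (by rw [le_div_iff₀ hp]; linarith)
  rw [← NNReal.coe_le_coe] at h
  push_cast at h
  rwa [Real.coe_toNNReal _ (by positivity), Real.coe_toNNReal _ (by positivity),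
    ← Real.rpow_mul hs, ← Real.rpow_mul ht, mul_div_cancel₀ _ hp.ne', Real.rpow_two,
    Real.rpow_two] at h

/-- Vectors with vanishing coordinates satisfy the parallelogram inequality asymptotically. -/
theorem parallelogram_le_of_tendsto_zero {p : ℕ → ℝ} (hp : ∀ n, 1 ≤ p n ∧ p n < 2)
    (hlim : Tendsto p atTop (𝓝 2))
    (ha : ∀ (n : ℕ) (x y : G n),
      ‖x + y‖ ^ 2 + ‖x - y‖ ^ 2 ≤ 2 * (‖x‖ ^ p n + ‖y‖ ^ p n) ^ (2 / p n))
    {W : Type*} [NormedAddCommGroup W] [NormedSpace 𝕜 W] {I : Type*} (U : Ultrafilter I)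
    (π : W →ₗ[𝕜] lp G 2)
    (hπ : ∀ v w, ‖v + w‖ ^ 2 + ‖v - w‖ ^ 2 - (‖π (v + w)‖ ^ 2 + ‖π (v - w)‖ ^ 2) =
      2 * (‖v‖ ^ 2 - ‖π v‖ ^ 2) + 2 * (‖w‖ ^ 2 - ‖π w‖ ^ 2))
    (hπ1 : ∀ w, ‖π w‖ ≤ ‖w‖)
    (x y : lp (fun _ : I => W) ∞)
    (hx : ∀ n, Tendsto (fun i => π (x i) n) (U : Filter I) (𝓝 0))
    (hy : ∀ n, Tendsto (fun i => π (y i) n) (U : Filter I) (𝓝 0)) :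
    ‖ultraMk 𝕜 U x + ultraMk 𝕜 U y‖ ^ 2 + ‖ultraMk 𝕜 U x - ultraMk 𝕜 U y‖ ^ 2 ≤
      2 * (‖ultraMk 𝕜 U x‖ ^ 2 + ‖ultraMk 𝕜 U y‖ ^ 2) := by
  have hc : Tendsto (fun n => (2 : ℝ) ^ (2 / p n - 1)) atTop (𝓝 1) := by
    have h1 : Tendsto (fun n => 2 / p n - 1) atTop (𝓝 (2 / 2 - 1)) :=
      (tendsto_const_nhds.div hlim two_ne_zero).sub_const 1
    have h2 := ((Real.continuous_const_rpow (two_ne_zero (α := ℝ))).tendsto (2 / 2 - 1)).comp h1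
    simpa [Function.comp_def] using h2
  have key : ∀ c : ℝ, 1 < c →
      ‖ultraMk 𝕜 U x + ultraMk 𝕜 U y‖ ^ 2 + ‖ultraMk 𝕜 U x - ultraMk 𝕜 U y‖ ^ 2 ≤
        2 * c * (‖ultraMk 𝕜 U x‖ ^ 2 + ‖ultraMk 𝕜 U y‖ ^ 2) := by
    intro c hc1
    obtain ⟨N, hN⟩ := eventually_atTop.1 (hc.eventually (gt_mem_nhds hc1))
    -- The first `N` coordinates are kept as they are, since they vanish in the limit. The others
    -- obey (a) with constant at most `c`, and the Hilbert part, by `hπ`, the exact law.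
    have hvw : ∀ v w : W, ‖v + w‖ ^ 2 + ‖v - w‖ ^ 2 ≤
        ∑ n ∈ Finset.range N, (‖π v n + π w n‖ ^ 2 + ‖π v n - π w n‖ ^ 2) +
          2 * c * (‖v‖ ^ 2 + ‖w‖ ^ 2) := by
      intro v w
      have h1 := (hasSum_norm_sq (π (v + w))).add (hasSum_norm_sq (π (v - w)))
      have h2 : HasSum (fun n => if n ∈ Finset.range N then
          (‖π v n + π w n‖ ^ 2 + ‖π v n - π w n‖ ^ 2) else 0)
          (∑ n ∈ Finset.range N, (‖π v n + π w n‖ ^ 2 + ‖π v n - π w n‖ ^ 2)) := by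
        have := hasSum_sum_of_ne_finset_zero (s := Finset.range N)
          (f := fun n => if n ∈ Finset.range N then
            (‖π v n + π w n‖ ^ 2 + ‖π v n - π w n‖ ^ 2) else 0)
          (L := .unconditional ℕ) (fun n hn => by simp only [hn, if_false])
        rwa [Finset.sum_congr rfl fun n hn => if_pos hn] at this
      have h3 := h2.add (((hasSum_norm_sq (π v)).add (hasSum_norm_sq (π w))).mul_left (2 * c))
      have h4 := hasSum_le (fun n => ?_) h1 h3
      · have hv := hπ v w
        have hv2 : ‖π v‖ ^ 2 ≤ ‖v‖ ^ 2 := pow_le_pow_left₀ (norm_nonneg _) (hπ1 v) 2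
        have hw2 : ‖π w‖ ^ 2 ≤ ‖w‖ ^ 2 := pow_le_pow_left₀ (norm_nonneg _) (hπ1 w) 2
        nlinarith [mul_nonneg (sub_nonneg.2 hc1.le) (sub_nonneg.2 hv2),
          mul_nonneg (sub_nonneg.2 hc1.le) (sub_nonneg.2 hw2)]
      · simp only [map_add, map_sub, lp.coeFn_add, lp.coeFn_sub, Pi.add_apply, Pi.sub_apply]
        split_ifs with hn
        · have : 0 ≤ 2 * c * (‖π v n‖ ^ 2 + ‖π w n‖ ^ 2) := by positivity
          simpa using this
        · have hn' : N ≤ n := by simpa using hn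
          refine (ha n _ _).trans ?_
          rw [zero_add, mul_assoc]
          gcongr
          refine (rpow_add_rpow_two_div_le (by linarith [(hp n).1]) (hp n).2.le
            (norm_nonneg _) (norm_nonneg _)).trans ?_
          gcongr
          exact (hN n hn').le
    have h1 : Tendsto (fun i => ‖x i + y i‖ ^ 2 + ‖x i - y i‖ ^ 2) (U : Filter I)
        (𝓝 (‖ultraMk 𝕜 U x + ultraMk 𝕜 U y‖ ^ 2 + ‖ultraMk 𝕜 U x - ultraMk 𝕜 U y‖ ^ 2)) :=
      ((tendsto_norm_ultraMk U (x + y)).pow 2).add ((tendsto_norm_ultraMk U (x - y)).pow 2)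
    have h2 : Tendsto (fun i => ∑ n ∈ Finset.range N,
        (‖π (x i) n + π (y i) n‖ ^ 2 + ‖π (x i) n - π (y i) n‖ ^ 2) +
          2 * c * (‖x i‖ ^ 2 + ‖y i‖ ^ 2)) (U : Filter I)
        (𝓝 (∑ n ∈ Finset.range N, (‖(0 : G n) + 0‖ ^ 2 + ‖(0 : G n) - 0‖ ^ 2) +
          2 * c * (‖ultraMk 𝕜 U x‖ ^ 2 + ‖ultraMk 𝕜 U y‖ ^ 2))) :=
      (tendsto_finsetSum _ fun n _ => (((hx n).add (hy n)).norm.pow 2).add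
        (((hx n).sub (hy n)).norm.pow 2)).add
        ((((tendsto_norm_ultraMk U x).pow 2).add ((tendsto_norm_ultraMk U y).pow 2)).const_mul _)
    simpa using le_of_tendsto_of_tendsto' h1 h2 fun i => hvw (x i) (y i)
  have hlim1 : Tendsto (fun c : ℝ => 2 * c * (‖ultraMk 𝕜 U x‖ ^ 2 + ‖ultraMk 𝕜 U y‖ ^ 2))
      (𝓝[>] 1) (𝓝 (2 * 1 * (‖ultraMk 𝕜 U x‖ ^ 2 + ‖ultraMk 𝕜 U y‖ ^ 2))) :=
    ((by fun_prop : Continuous fun c : ℝ =>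
      2 * c * (‖ultraMk 𝕜 U x‖ ^ 2 + ‖ultraMk 𝕜 U y‖ ^ 2)).tendsto 1).mono_left
      nhdsWithin_le_nhds
  rw [mul_one] at hlim1
  exact ge_of_tendsto hlim1 (eventually_nhdsWithin_of_forall fun c hc => key c hc)

/-- Applying the inequality to `x + y` and `x - y` gives the reverse inequality. -/
theorem parallelogram_eq_of_le {𝕜 V : Type*} [RCLike 𝕜] [NormedAddCommGroup V] [NormedSpace 𝕜 V]
    (h : ∀ x y : V, ‖x + y‖ ^ 2 + ‖x - y‖ ^ 2 ≤ 2 * (‖x‖ ^ 2 + ‖y‖ ^ 2)) (x y : V) :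
    ‖x + y‖ * ‖x + y‖ + ‖x - y‖ * ‖x - y‖ = 2 * (‖x‖ * ‖x‖ + ‖y‖ * ‖y‖) := by
  have h1 := h x y
  have h2 := h (x + y) (x - y)
  have e1 : x + y + (x - y) = (2 : 𝕜) • x := by rw [two_smul]; abel
  have e2 : x + y - (x - y) = (2 : 𝕜) • y := by rw [two_smul]; abel
  rw [e1, e2, norm_smul, norm_smul, RCLike.norm_ofNat] at h2
  nlinarith

/-- The Hilbert summand is the kernel of `D`. Orthogonality makes `D` a contraction, so the kernel
is closed, and `hpar` supplies its inner product. -/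
theorem IsHilbertExtension.of_retraction {E Z : Type u} [NormedAddCommGroup E]
    [NormedSpace 𝕜 E] [NormedAddCommGroup Z] [NormedSpace 𝕜 Z] [CompleteSpace Z]
    (D : Z →ₗ[𝕜] E) (σ : E →ₗᵢ[𝕜] Z) (hDσ : ∀ f, D (σ f) = f)
    (horth : ∀ f k, D k = 0 → ‖σ f + k‖ ^ 2 = ‖f‖ ^ 2 + ‖k‖ ^ 2)
    (hpar : ∀ x y, D x = 0 → D y = 0 →
      ‖x + y‖ ^ 2 + ‖x - y‖ ^ 2 ≤ 2 * (‖x‖ ^ 2 + ‖y‖ ^ 2)) :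
    IsHilbertExtension 𝕜 E Z := by
  have hdec : ∀ z, D (z - σ (D z)) = 0 := fun z => by rw [map_sub, hDσ, sub_self]
  have hnorm : ∀ z, ‖z‖ ^ 2 = ‖D z‖ ^ 2 + ‖z - σ (D z)‖ ^ 2 := fun z => by
    rw [← horth _ _ (hdec z), add_sub_cancel]
  let K : Submodule 𝕜 Z := LinearMap.ker D
  have hDc : Continuous D := AddMonoidHomClass.continuous_of_bound D 1 fun z => by
    rw [one_mul]
    refine (pow_le_pow_iff_left₀ (norm_nonneg _) (norm_nonneg _) two_ne_zero).1 ?_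
    rw [hnorm z]
    exact le_add_of_nonneg_right (sq_nonneg _)
  have hKc : IsClosed (K : Set Z) := isClosed_singleton.preimage hDc
  have hparK : ∀ x y : K, ‖x + y‖ ^ 2 + ‖x - y‖ ^ 2 ≤ 2 * (‖x‖ ^ 2 + ‖y‖ ^ 2) :=
    fun x y => hpar x y x.2 y.2
  let Φ : Z ≃ₗ[𝕜] E × K :=
    { toFun := fun z => (D z, ⟨z - σ (D z), hdec z⟩)
      invFun := fun q => σ q.1 + q.2
      map_add' := fun x y => Prod.ext (map_add D x y) (Subtype.ext (by
        change x + y - σ (D (x + y)) = x - σ (D x) + (y - σ (D y))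
        rw [map_add, map_add]
        abel))
      map_smul' := fun c x => Prod.ext (map_smul D c x) (Subtype.ext (by
        change c • x - σ (D (c • x)) = c • (x - σ (D x))
        rw [map_smul, map_smul, smul_sub]))
      left_inv := fun z => add_sub_cancel _ _
      right_inv := fun q => by
        have hq : D q.2 = 0 := q.2.2
        refine Prod.ext ?_ (Subtype.ext ?_)
        · simp [hDσ, hq]
        · simp [hDσ, hq] }
  exact ⟨K, inferInstance, InnerProductSpace.ofNorm 𝕜 (parallelogram_eq_of_le (𝕜 := 𝕜) hparK),
    hKc.completeSpace_coe, Φ, hnorm⟩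

theorem IsHilbertExtension.ultrapower [∀ n, FiniteDimensional 𝕜 (G n)] {p : ℕ → ℝ}
    (hp : ∀ n, 1 ≤ p n ∧ p n < 2)
    (hlim : Tendsto p atTop (𝓝 2))
    (ha : ∀ (n : ℕ) (x y : G n),
      ‖x + y‖ ^ 2 + ‖x - y‖ ^ 2 ≤ 2 * (‖x‖ ^ p n + ‖y‖ ^ p n) ^ (2 / p n))
    {W : Type u} [NormedAddCommGroup W] [NormedSpace 𝕜 W] [CompleteSpace W]
    (hW : IsHilbertExtension 𝕜 (lp G 2) W) {I : Type u} (U : Ultrafilter I) :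
    IsHilbertExtension 𝕜 (lp G 2) (BanachUltrapower 𝕜 U W) := by
  obtain ⟨H, _, _, _, Φ, hΦ⟩ := hW
  let π : W →ₗ[𝕜] lp G 2 := LinearMap.fst 𝕜 _ H ∘ₗ Φ.toLinearMap
  let σ : lp G 2 →ₗᵢ[𝕜] W :=
    { toLinearMap := Φ.symm.toLinearMap ∘ₗ LinearMap.inl 𝕜 _ H
      norm_map' := fun f => by
        have := hΦ (Φ.symm (f, 0))
        rw [← sq_eq_sq₀ (norm_nonneg _) (norm_nonneg _)]
        simpa using this }
  have hπdef : ∀ w, π w = (Φ w).1 := fun w => rfl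
  have hσΦ : ∀ f, Φ (σ f) = (f, 0) := fun f => Φ.apply_symm_apply _
  have hπσ : ∀ f, π (σ f) = f := fun f => by rw [hπdef, hσΦ]
  have hπ1 : ∀ w, ‖π w‖ ≤ ‖w‖ := fun w => by
    refine (pow_le_pow_iff_left₀ (norm_nonneg _) (norm_nonneg _) two_ne_zero).1 ?_
    rw [hΦ w]
    exact le_add_of_nonneg_right (sq_nonneg _)
  have hσ : ∀ f w, ‖σ f + w‖ ^ 2 = ‖w‖ ^ 2 + (‖f + π w‖ ^ 2 - ‖π w‖ ^ 2) := fun f w => by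
    rw [hΦ, hΦ w, map_add, hσΦ, hπdef]
    simp only [Prod.fst_add, Prod.snd_add, zero_add]
    ring
  have hπ : ∀ v w, ‖v + w‖ ^ 2 + ‖v - w‖ ^ 2 - (‖π (v + w)‖ ^ 2 + ‖π (v - w)‖ ^ 2) =
      2 * (‖v‖ ^ 2 - ‖π v‖ ^ 2) + 2 * (‖w‖ ^ 2 - ‖π w‖ ^ 2) := fun v w => by
    rw [hΦ (v + w), hΦ (v - w), hΦ v, hΦ w]
    simp only [hπdef, map_add, map_sub, Prod.fst_add, Prod.fst_sub, Prod.snd_add, Prod.snd_sub]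
    have := parallelogram_law_with_norm 𝕜 (Φ v).2 (Φ w).2
    linarith
  obtain ⟨D, hD⟩ := exists_coordinate_limit U π hπ1
  have hDσ : ∀ f, D (ultraDiag 𝕜 U W (σ f)) = f := fun f => by
    ext n
    refine tendsto_nhds_unique (hD _ n) ?_
    simp [hπσ]
  have horth : ∀ f k, D k = 0 → ‖ultraDiag 𝕜 U W (σ f) + k‖ ^ 2 = ‖f‖ ^ 2 + ‖k‖ ^ 2 := by
    intro f k hk
    obtain ⟨x, rfl⟩ := ultraMk_surjective U k
    exact norm_ultraDiag_add_sq U π σ hσ x (fun n => by simpa [hk] using hD x n) f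
  refine IsHilbertExtension.of_retraction D ((ultraDiag 𝕜 U W).comp σ) hDσ horth ?_
  intro k l hk hl
  obtain ⟨x, rfl⟩ := ultraMk_surjective U k
  obtain ⟨y, rfl⟩ := ultraMk_surjective U l
  exact parallelogram_le_of_tendsto_zero hp hlim ha U π hπ hπ1 x y
    (fun n => by simpa [hk] using hD x n) (fun n => by simpa [hl] using hD y n)

end HilbertExtension

/-! ### Comparison of expansions at zero -/

section Analytic

theorem rpow_two_div_eq_sq {x r : ℝ} (hx : 0 ≤ x) : x ^ (2 / r) = (x ^ (1 / r)) ^ 2 := by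
  rw [← Real.rpow_natCast, ← Real.rpow_mul hx]
  congr 1
  push_cast
  ring

theorem rpow_two_div_rpow {x r : ℝ} (hx : 0 ≤ x) (hr : r ≠ 0) : (x ^ r) ^ (2 / r) = x ^ 2 := by
  rw [← Real.rpow_mul hx, mul_div_cancel₀ _ hr, Real.rpow_two]

theorem rpow_add_rpow_two_div_anti {a b q r : ℝ} (ha : 0 ≤ a) (hb : 0 ≤ b) (hq : 0 < q)
    (hqr : q ≤ r) : (a ^ r + b ^ r) ^ (2 / r) ≤ (a ^ q + b ^ q) ^ (2 / q) := by
  rw [rpow_two_div_eq_sq (by positivity), rpow_two_div_eq_sq (by positivity)]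
  exact pow_le_pow_left₀ (by positivity) (Real.rpow_add_rpow_le ha hb hq hqr) 2

theorem hasDerivAt_nonneg_of_forall_pos {F : ℝ → ℝ} {d : ℝ} (hF : HasDerivAt F d 0)
    (h0 : F 0 = 0) (h : ∀ s, 0 < s → 0 ≤ F s) : 0 ≤ d := by
  have h1 : Tendsto (slope F 0) (𝓝[>] 0) (𝓝 d) :=
    (hasDerivAt_iff_tendsto_slope.1 hF).mono_left
      (nhdsWithin_mono _ fun x hx => ne_of_gt hx)
  refine ge_of_tendsto h1 (eventually_nhdsWithin_of_forall fun s hs => ?_)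
  have hs' : (0 : ℝ) < s := hs
  rw [slope_def_field, h0, sub_zero, sub_zero]
  exact div_nonneg (h s hs') hs'.le

theorem hasDerivAt_rpow_zero {r : ℝ} (hr : 1 < r) : HasDerivAt (fun s : ℝ => s ^ r) 0 0 := by
  have := Real.hasDerivAt_rpow_const (x := 0) (p := r) (Or.inr hr.le)
  rwa [Real.zero_rpow (by linarith), mul_zero] at this

/-- Comparing the expansions at `t = 0`, only the part of exponent `p` can carry an
`ℓ_p`-pair. -/
theorem eq_zero_of_rpow_le {p q A₀ B₀ A₁ B₁ A₂ B₂ : ℝ} (hp : 1 ≤ p) (hp2 : p < 2) (hpq : p < q)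
    (hq : q ≤ 2) (hA₀ : 0 ≤ A₀) (hB₀ : 0 ≤ B₀) (hA₁ : 0 ≤ A₁) (hB₁ : 0 ≤ B₁)
    (hA : A₀ ^ 2 + A₁ ^ 2 + A₂ ^ 2 = 1) (hB : B₀ ^ 2 + B₁ ^ 2 + B₂ ^ 2 ≤ 1)
    (h : ∀ t : ℝ, 0 < t → (1 + t ^ p) ^ (2 / p) ≤
      (A₀ ^ p + (t * B₀) ^ p) ^ (2 / p) + (A₁ ^ q + (t * B₁) ^ q) ^ (2 / q) +
        (A₂ ^ 2 + (t * B₂) ^ 2)) :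
    B₁ = 0 ∧ B₂ = 0 := by
  have hp0 : 0 < p := by linarith
  have hq0 : 0 < q := by linarith
  -- The substitution `s = t ^ p` makes all terms differentiable at 0. Those in `B₁` and `B₂` carry
  -- powers of `s` greater than 1 and have derivative 0.
  let F : ℝ → ℝ := fun s => (A₀ ^ p + s * B₀ ^ p) ^ (2 / p) +
    (A₁ ^ q + s ^ (q / p) * B₁ ^ q) ^ (2 / q) + (A₂ ^ 2 + s ^ (2 / p) * B₂ ^ 2) -
      (1 + s) ^ (2 / p)
  have h2p : 1 < 2 / p := by rw [lt_div_iff₀ hp0]; linarith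
  have h2q : 1 ≤ 2 / q := by rw [le_div_iff₀ hq0]; linarith
  have hqp : 1 < q / p := by rw [lt_div_iff₀ hp0]; linarith
  have hd : HasDerivAt F (1 * B₀ ^ p * (2 / p) * (A₀ ^ p + 0 * B₀ ^ p) ^ (2 / p - 1) +
      0 * B₁ ^ q * (2 / q) * (A₁ ^ q + 0 ^ (q / p) * B₁ ^ q) ^ (2 / q - 1) + 0 * B₂ ^ 2 -
      1 * (2 / p) * (1 + 0) ^ (2 / p - 1)) 0 := by
    refine HasDerivAt.sub (HasDerivAt.add (HasDerivAt.add ?_ ?_) ?_) ?_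
    · exact (((hasDerivAt_id (0 : ℝ)).mul_const (B₀ ^ p)).const_add (A₀ ^ p)).rpow_const
        (Or.inr h2p.le)
    · exact (((hasDerivAt_rpow_zero hqp).mul_const (B₁ ^ q)).const_add (A₁ ^ q)).rpow_const
        (Or.inr h2q)
    · exact ((hasDerivAt_rpow_zero h2p).mul_const (B₂ ^ 2)).const_add (A₂ ^ 2)
    · exact ((hasDerivAt_id (0 : ℝ)).const_add 1).rpow_const (Or.inr h2p.le)
  have hd0 := hasDerivAt_nonneg_of_forall_pos hd (by
    simp only [F]
    rw [Real.zero_rpow (by positivity), Real.zero_rpow (by positivity), zero_mul, zero_mul,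
      zero_mul, add_zero, add_zero, add_zero, add_zero, rpow_two_div_rpow hA₀ hp0.ne',
      rpow_two_div_rpow hA₁ hq0.ne', Real.one_rpow]
    linarith) (fun s hs => by
      have hts := h (s ^ (1 / p)) (by positivity)
      have e1 : (s ^ (1 / p)) ^ p = s := by
        rw [← Real.rpow_mul hs.le, one_div_mul_cancel hp0.ne', Real.rpow_one]
      have e2 : (s ^ (1 / p)) ^ q = s ^ (q / p) := by
        rw [← Real.rpow_mul hs.le]; congr 1; ring
      have e3 : (s ^ (1 / p)) ^ 2 = s ^ (2 / p) := (rpow_two_div_eq_sq hs.le).symm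
      rw [Real.mul_rpow (by positivity) hB₀, Real.mul_rpow (by positivity) hB₁, mul_pow, e1, e2,
        e3] at hts
      exact sub_nonneg.2 hts)
  rw [zero_mul, zero_mul, zero_mul, zero_mul, add_zero, add_zero, add_zero, zero_mul, add_zero,
    Real.one_rpow, one_mul, one_mul, mul_one] at hd0
  -- This is the sign of `F'(0)` divided by `2 / p`. As `A₀, B₀ ≤ 1`, it forces `B₀ = 1`, and `hB`
  -- leaves no room for `B₁` and `B₂`.
  have hkey : 1 ≤ B₀ ^ p * (A₀ ^ p) ^ (2 / p - 1) := by
    have h2p0 : 0 < 2 / p := by linarith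
    by_contra! hlt
    nlinarith
  have hB₀1 : B₀ ≤ 1 := by nlinarith [sq_nonneg B₁, sq_nonneg B₂]
  have hA₀1 : A₀ ≤ 1 := by nlinarith [sq_nonneg A₁, sq_nonneg A₂]
  have hApow : (A₀ ^ p) ^ (2 / p - 1) ≤ 1 :=
    Real.rpow_le_one (by positivity) (Real.rpow_le_one hA₀ hA₀1 hp0.le) (by linarith)
  have hBpow : 1 ≤ B₀ ^ p := hkey.trans (mul_le_of_le_one_right (by positivity) hApow)
  have hB₀' : 1 ≤ B₀ := by
    by_contra! hlt
    exact absurd hBpow (not_le.2 (Real.rpow_lt_one hB₀ hlt hp0))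
  have hB₀eq : B₀ = 1 := le_antisymm hB₀1 hB₀'
  rw [hB₀eq] at hB
  constructor <;> nlinarith [sq_nonneg B₁, sq_nonneg B₂]

end Analytic

/-! ### Coordinate projections and images of ℓ_c-pairs -/

section Coordinates

variable {𝕜 : Type*} [RCLike 𝕜] {G : ℕ → Type u} [∀ n, NormedAddCommGroup (G n)]
  [∀ n, NormedSpace 𝕜 (G n)]

/-- On the surviving coordinates `q ≤ p n`, so monotonicity of `ℓ_r`-norms in `r` lets (a) be used
with exponent `q`. Minkowski's inequality in `ℓ_{2/q}`, applied to the `q`-th powers of the norms,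
sums the estimates. -/
theorem norm_add_sq_add_norm_sub_sq_le {p : ℕ → ℝ}
    (ha : ∀ (n : ℕ) (x y : G n),
      ‖x + y‖ ^ 2 + ‖x - y‖ ^ 2 ≤ 2 * (‖x‖ ^ p n + ‖y‖ ^ p n) ^ (2 / p n))
    {q : ℝ} (hq : 0 < q) (hq2 : q ≤ 2) (u v : lp G 2)
    (h : ∀ n, p n < q → u n = 0 ∧ v n = 0) :
    ‖u + v‖ ^ 2 + ‖u - v‖ ^ 2 ≤ 2 * (‖u‖ ^ q + ‖v‖ ^ q) ^ (2 / q) := by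
  have hs : ∀ w : lp G 2, HasSum (fun n => (‖w n‖ ^ q) ^ (2 / q)) ((‖w‖ ^ q) ^ (2 / q)) := by
    intro w
    simp only [rpow_two_div_rpow (norm_nonneg _) hq.ne']
    exact hasSum_norm_sq w
  obtain ⟨C, hC0, hC, hCs⟩ := Real.Lp_add_le_hasSum_of_nonneg
    (show 1 ≤ 2 / q by rw [le_div_iff₀ hq]; linarith) (fun n => by positivity)
    (fun n => by positivity) (by positivity) (by positivity) (hs u) (hs v)
  have h1 := hasSum_le (fun n => ?_) ((hasSum_norm_sq (u + v)).add (hasSum_norm_sq (u - v)))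
    (hCs.mul_left 2)
  · refine h1.trans ?_
    gcongr
  · simp only [lp.coeFn_add, lp.coeFn_sub, Pi.add_apply, Pi.sub_apply]
    by_cases hn : p n < q
    · simp [(h n hn).1, (h n hn).2, Real.zero_rpow hq.ne', Real.zero_rpow (div_pos two_pos hq).ne']
    · refine (ha n _ _).trans ?_
      gcongr 2 * ?_
      exact rpow_add_rpow_two_div_anti (norm_nonneg _) (norm_nonneg _) hq (not_lt.1 hn)

open Classical in
/-- The projection onto the coordinates in `S`. -/
def coordProj (𝕜 : Type*) [RCLike 𝕜] {G : ℕ → Type u} [∀ n, NormedAddCommGroup (G n)]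
    [∀ n, NormedSpace 𝕜 (G n)] (S : Set ℕ) : lp G 2 →ₗ[𝕜] lp G 2 where
  toFun u := ⟨fun n => if n ∈ S then u n else 0, by
    refine memℓp_gen ?_
    refine ((lp.memℓp u).summable (by simp)).of_nonneg_of_le (fun n => by positivity) fun n => ?_
    split_ifs <;> simp⟩
  map_add' u v := by
    ext n
    change (if n ∈ S then (u + v) n else 0) =
      (if n ∈ S then u n else 0) + (if n ∈ S then v n else 0)
    split_ifs <;> simp
  map_smul' c u := by
    ext n
    change (if n ∈ S then (c • u) n else 0) = c • (if n ∈ S then u n else 0)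
    split_ifs <;> simp

theorem coordProj_apply_of_mem {S : Set ℕ} {n : ℕ} (hn : n ∈ S) (u : lp G 2) :
    coordProj 𝕜 S u n = u n := if_pos hn

theorem coordProj_apply_of_notMem {S : Set ℕ} {n : ℕ} (hn : n ∉ S) (u : lp G 2) :
    coordProj 𝕜 S u n = 0 := if_neg hn

theorem norm_sq_eq_coordProj_add (S : Set ℕ) (u : lp G 2) :
    ‖u‖ ^ 2 = ‖coordProj 𝕜 S u‖ ^ 2 + ‖coordProj 𝕜 Sᶜ u‖ ^ 2 := by
  refine (hasSum_norm_sq u).unique ?_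
  convert (hasSum_norm_sq (coordProj 𝕜 S u)).add (hasSum_norm_sq (coordProj 𝕜 Sᶜ u)) using 2 with n
  by_cases hn : n ∈ S
  · rw [coordProj_apply_of_mem hn, coordProj_apply_of_notMem (by simpa using hn)]; simp
  · rw [coordProj_apply_of_notMem hn, coordProj_apply_of_mem (by simpa using hn)]; simp

theorem norm_ofReal_smul {V : Type*} [NormedAddCommGroup V] [NormedSpace 𝕜 V] (t : ℝ) (v : V) :
    ‖(t : 𝕜) • v‖ = |t| * ‖v‖ := by
  rw [norm_smul, RCLike.norm_ofReal]

/-- Only finitely many exponents are at most `(c + 2) / 2`, so those above `c` stay away from it.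
This gives one exponent `q > c` for all higher coordinates at once. -/
theorem exists_exponent_gap {p : ℕ → ℝ} (hlim : Tendsto p atTop (𝓝 2)) {c : ℝ} (hc : c < 2) :
    ∃ q, c < q ∧ q ≤ 2 ∧ ∀ m, p m ≠ c → p m < q → p m < c := by
  obtain ⟨N, hN⟩ := eventually_atTop.1
    (hlim.eventually (lt_mem_nhds (show (c + 2) / 2 < 2 by linarith)))
  let s := (Finset.range N).filter fun m => c < p m
  by_cases hs : s.Nonempty
  · obtain ⟨m₀, hm₀, hmin⟩ := s.exists_min_image p hs
    have hm₀c : c < p m₀ := (Finset.mem_filter.1 hm₀).2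
    refine ⟨min (p m₀) ((c + 2) / 2), lt_min hm₀c (by linarith),
      (min_le_right _ _).trans (by linarith), fun m hne hm => ?_⟩
    by_contra! hcm
    have hcm' := lt_of_le_of_ne hcm hne.symm
    rcases lt_or_ge m N with h | h
    · exact absurd (hmin m (Finset.mem_filter.2 ⟨Finset.mem_range.2 h, hcm'⟩))
        (not_le.2 (hm.trans_le (min_le_left _ _)))
    · exact absurd (hN m h) (not_lt.2 (hm.le.trans (min_le_right _ _)))
  · refine ⟨(c + 2) / 2, by linarith, by linarith, fun m hne hm => ?_⟩
    by_contra! hcm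
    have hcm' := lt_of_le_of_ne hcm hne.symm
    rcases lt_or_ge m N with h | h
    · exact hs ⟨m, Finset.mem_filter.2 ⟨Finset.mem_range.2 h, hcm'⟩⟩
    · exact absurd (hN m h) (not_lt.2 hm.le)

/-- The image of an `ℓ_c`-pair in the `2`-sum of an `ℓ₂`-sum and a Hilbert space is supported on
the coordinates of exponent `c`, provided that the coordinates of smaller exponent vanish. -/
theorem eq_zero_of_ellPair_image {p : ℕ → ℝ} (hlim : Tendsto p atTop (𝓝 2))
    (ha : ∀ (n : ℕ) (x y : G n),
      ‖x + y‖ ^ 2 + ‖x - y‖ ^ 2 ≤ 2 * (‖x‖ ^ p n + ‖y‖ ^ p n) ^ (2 / p n))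
    {H : Type*} [NormedAddCommGroup H] [InnerProductSpace 𝕜 H] {c : ℝ} (hc : 1 ≤ c) (hc2 : c < 2)
    (u v : lp G 2) (h k : H) (hlow : ∀ n, p n < c → u n = 0 ∧ v n = 0)
    (heq : ∀ t : ℝ, ‖u + (t : 𝕜) • v‖ ^ 2 + ‖h + (t : 𝕜) • k‖ ^ 2 = (1 + |t| ^ c) ^ (2 / c))
    (hv : ‖v‖ ^ 2 + ‖k‖ ^ 2 ≤ 1) : (∀ n, p n ≠ c → v n = 0) ∧ k = 0 := by
  obtain ⟨q, hcq, hq2, hq⟩ := exists_exponent_gap hlim hc2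
  let S : Set ℕ := {n | p n = c}
  have hB := hv
  rw [norm_sq_eq_coordProj_add (𝕜 := 𝕜) S v] at hB
  have hA : ‖u‖ ^ 2 + ‖h‖ ^ 2 = 1 := by
    have := heq 0
    simpa [Real.zero_rpow (show c ≠ 0 by linarith)] using this
  rw [norm_sq_eq_coordProj_add (𝕜 := 𝕜) S u] at hA
  have hmain := eq_zero_of_rpow_le hc hc2 hcq hq2 (norm_nonneg _) (norm_nonneg _) (norm_nonneg _)
    (norm_nonneg _) hA hB (fun t ht => by
      -- The identities at `t` and `-t` are added, because (a) bounds only the sum of the two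
      -- squares.
      have h1 := heq t
      have h2 := heq (-t)
      have e1 : ((-t : ℝ) : 𝕜) • v = -((t : 𝕜) • v) := by push_cast; rw [neg_smul]
      have e2 : ((-t : ℝ) : 𝕜) • k = -((t : 𝕜) • k) := by push_cast; rw [neg_smul]
      rw [abs_neg, e1, e2, ← sub_eq_add_neg, ← sub_eq_add_neg] at h2
      have h3 := parallelogram_law_with_norm 𝕜 h ((t : 𝕜) • k)
      have h4 : ∀ R : Set ℕ, ∀ r : ℝ, 0 < r → r ≤ 2 → (∀ n ∈ R, p n < r → u n = 0 ∧ v n = 0) →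
          ‖coordProj 𝕜 R (u + (t : 𝕜) • v)‖ ^ 2 + ‖coordProj 𝕜 R (u - (t : 𝕜) • v)‖ ^ 2 ≤
          2 * (‖coordProj 𝕜 R u‖ ^ r + (t * ‖coordProj 𝕜 R v‖) ^ r) ^ (2 / r) := by
        intro R r hr hr2 hR
        have := norm_add_sq_add_norm_sub_sq_le ha hr hr2 (coordProj 𝕜 R u)
          ((t : 𝕜) • coordProj 𝕜 R v) (fun n hn => by
            by_cases hnR : n ∈ R
            · rw [lp.coeFn_smul, Pi.smul_apply, coordProj_apply_of_mem hnR,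
                coordProj_apply_of_mem hnR, (hR n hnR hn).1, (hR n hnR hn).2, smul_zero]
              exact ⟨rfl, rfl⟩
            · rw [lp.coeFn_smul, Pi.smul_apply, coordProj_apply_of_notMem hnR,
                coordProj_apply_of_notMem hnR, smul_zero]
              exact ⟨rfl, rfl⟩)
        rwa [norm_ofReal_smul, abs_of_pos ht, ← map_smul, ← map_add, ← map_sub] at this
      have h5 := h4 S c (by linarith) hc2.le fun n _ => hlow n
      have h6 := h4 Sᶜ q (by linarith) hq2 fun n hn hnq => hlow n (hq n hn hnq)
      rw [norm_sq_eq_coordProj_add (𝕜 := 𝕜) S, abs_of_pos ht] at h1 h2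
      rw [norm_ofReal_smul, abs_of_pos ht] at h3
      nlinarith)
  refine ⟨fun n hn => ?_, norm_eq_zero.1 hmain.2⟩
  have h0 : coordProj 𝕜 Sᶜ v = 0 := norm_eq_zero.1 hmain.1
  rw [← coordProj_apply_of_mem (𝕜 := 𝕜) (S := Sᶜ) (n := n) hn v, h0]
  rfl

end Coordinates

/-! ### Rigidity of isometries into Hilbert extensions -/

section IsometryOnto

variable {𝕜 : Type*} [RCLike 𝕜] {G : ℕ → Type u} [∀ n, NormedAddCommGroup (G n)]
  [∀ n, NormedSpace 𝕜 (G n)]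

/-- The vectors supported on the coordinates with exponent less than `c`. -/
def lowerExponentSubmodule (𝕜 : Type*) [RCLike 𝕜] {G : ℕ → Type u} [∀ n, NormedAddCommGroup (G n)]
    [∀ n, NormedSpace 𝕜 (G n)] (p : ℕ → ℝ) (c : ℝ) : Submodule 𝕜 (lp G 2) where
  carrier := {u | ∀ n, c ≤ p n → u n = 0}
  zero_mem' := fun n _ => rfl
  add_mem' := fun {u v} hu hv n hn => by
    rw [lp.coeFn_add, Pi.add_apply, hu n hn, hv n hn, add_zero]
  smul_mem' := fun a u hu n hn => by
    rw [lp.coeFn_smul, Pi.smul_apply, hu n hn, smul_zero]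

theorem mem_lowerExponentSubmodule {p : ℕ → ℝ} {c : ℝ} {u : lp G 2} :
    u ∈ lowerExponentSubmodule 𝕜 p c ↔ ∀ n, c ≤ p n → u n = 0 := Iff.rfl

theorem finite_setOf_lt_of_tendsto {p : ℕ → ℝ} (hlim : Tendsto p atTop (𝓝 2)) {c : ℝ}
    (hc : c < 2) : {n | p n < c}.Finite := by
  obtain ⟨N, hN⟩ := eventually_atTop.1 (hlim.eventually (lt_mem_nhds hc))
  refine (Set.finite_lt_nat N).subset fun n hn => ?_
  by_contra h
  exact absurd (hN n (not_lt.1 h)) (not_lt.2 (le_of_lt hn))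

theorem finiteDimensional_lowerExponentSubmodule [∀ n, FiniteDimensional 𝕜 (G n)] {p : ℕ → ℝ}
    (hlim : Tendsto p atTop (𝓝 2)) {c : ℝ} (hc : c < 2) :
    FiniteDimensional 𝕜 (lowerExponentSubmodule 𝕜 (G := G) p c) := by
  have : Finite {n // p n < c} := (finite_setOf_lt_of_tendsto hlim hc).to_subtype
  let L : lowerExponentSubmodule 𝕜 (G := G) p c →ₗ[𝕜] ∀ n : {n // p n < c}, G n :=
    { toFun := fun u n => u.1 n
      map_add' := fun _ _ => rfl
      map_smul' := fun _ _ => rfl }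
  refine FiniteDimensional.of_injective L fun u v huv => Subtype.ext (lp.ext (funext fun n => ?_))
  rcases lt_or_ge (p n) c with h | h
  · exact congrFun huv ⟨n, h⟩
  · rw [u.2 n h, v.2 n h]

theorem single_mem_lowerExponentSubmodule {p : ℕ → ℝ} {c : ℝ} {m : ℕ} (hm : p m < c) (x : G m) :
    lp.single 2 m x ∈ lowerExponentSubmodule 𝕜 (G := G) p c := fun _ hn =>
  lp.single_apply_ne _ _ _ fun h => absurd hm (not_lt.2 (h ▸ hn))

theorem eq_sum_single_of_mem_lowerExponentSubmodule {p : ℕ → ℝ} {c : ℝ}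
    (hfin : {n | p n < c}.Finite) {u : lp G 2} (hu : u ∈ lowerExponentSubmodule 𝕜 p c) :
    u = ∑ m ∈ hfin.toFinset, lp.single 2 m (u m) := by
  refine lp.ext (funext fun n => ?_)
  by_cases hn : n ∈ hfin.toFinset
  · rw [lp.coeFn_sum, Finset.sum_apply, Finset.sum_eq_single_of_mem n hn fun m _ hm =>
      lp.single_apply_ne _ _ _ hm.symm, lp.single_apply_self]
  · rw [sum_single_apply_of_notMem u hn]
    exact hu n (not_lt.1 fun h => hn (hfin.mem_toFinset.2 h))

theorem norm_single_two {m : ℕ} (x : G m) : ‖(lp.single 2 m x : lp G 2)‖ = ‖x‖ :=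
  lp.norm_single (by simp) m x

theorem norm_single_add_sq (m : ℕ) (x : G m) (b : lp G 2) :
    ‖lp.single 2 m x + b‖ ^ 2 = ‖b‖ ^ 2 + (‖x + b m‖ ^ 2 - ‖b m‖ ^ 2) := by
  rw [norm_add_sq_of_forall_notMem (s := {m}) (fun n hn =>
    lp.single_apply_ne _ _ _ (by simpa using hn)) b, Finset.sum_singleton, lp.single_apply_self]

variable {H : Type*} [NormedAddCommGroup H] [InnerProductSpace 𝕜 H]

/-- `T` preserves the coordinates of exponent `p m` on the `m`-th summand. -/
def PreservesExponent (p : ℕ → ℝ) (T : lp G 2 →ₗ[𝕜] lp G 2 × H) (m : ℕ) : Prop :=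
  ∀ x : G m, (∀ n, p n ≠ p m → (T (lp.single 2 m x)).1 n = 0) ∧ (T (lp.single 2 m x)).2 = 0

/-- The subspace is finite dimensional and `T` maps it into itself, with zero Hilbert component;
being injective, `T` is onto there. -/
theorem exists_preimage_lowerExponentSubmodule [∀ n, FiniteDimensional 𝕜 (G n)] {p : ℕ → ℝ}
    (hlim : Tendsto p atTop (𝓝 2)) (T : lp G 2 →ₗ[𝕜] lp G 2 × H)
    (hT : ∀ x, ‖x‖ ^ 2 = ‖(T x).1‖ ^ 2 + ‖(T x).2‖ ^ 2) {c : ℝ} (hc : c < 2)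
    (h : ∀ m, p m < c → PreservesExponent p T m) {g : lp G 2}
    (hg : g ∈ lowerExponentSubmodule 𝕜 p c) :
    ∃ f ∈ lowerExponentSubmodule 𝕜 p c, T f = (g, 0) := by
  have hfin := finite_setOf_lt_of_tendsto hlim hc
  have := finiteDimensional_lowerExponentSubmodule (𝕜 := 𝕜) (G := G) hlim hc
  have hmaps : ∀ u ∈ lowerExponentSubmodule 𝕜 p c,
      T u ∈ (lowerExponentSubmodule 𝕜 (G := G) p c).prod (⊥ : Submodule 𝕜 H) := by
    intro u hu
    rw [eq_sum_single_of_mem_lowerExponentSubmodule hfin hu, map_sum]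
    refine Submodule.sum_mem _ fun m hm => ?_
    have hm' : p m < c := hfin.mem_toFinset.1 hm
    refine Submodule.mem_prod.2 ⟨fun n hn => ?_, ?_⟩
    · exact (h m hm' (u m)).1 n (hm'.trans_le hn).ne'
    · exact (Submodule.mem_bot 𝕜).2 (h m hm' (u m)).2
  let L : lowerExponentSubmodule 𝕜 (G := G) p c →ₗ[𝕜] lowerExponentSubmodule 𝕜 (G := G) p c :=
    (LinearMap.fst 𝕜 _ H ∘ₗ T).restrict fun u hu => (Submodule.mem_prod.1 (hmaps u hu)).1
  have hL : Function.Injective L := by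
    refine (injective_iff_map_eq_zero L).2 fun u hu => ?_
    have h1 : (T u).1 = 0 := congrArg Subtype.val hu
    have h2 : (T u).2 = 0 := (Submodule.mem_bot 𝕜).1 (Submodule.mem_prod.1 (hmaps u u.2)).2
    have h3 := hT u
    rw [h1, h2] at h3
    exact Subtype.ext (norm_eq_zero.1 (by simpa using h3))
  obtain ⟨f, hf⟩ := LinearMap.surjective_of_injective hL ⟨g, hg⟩
  refine ⟨f, f.2, Prod.ext (congrArg Subtype.val hf) ?_⟩
  exact (Submodule.mem_bot 𝕜).1 (Submodule.mem_prod.1 (hmaps f f.2)).2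

/-- The coordinate `v m` is itself the image of some `f` of lower exponents, hence 2-orthogonal to
the `n`-th summand. Adding `f` increases the squared norm by `‖v m‖ ^ 2` in the source but by `3 *
‖v m‖ ^ 2` in the image. -/
theorem image_single_apply_eq_zero_of_lt [∀ n, FiniteDimensional 𝕜 (G n)] {p : ℕ → ℝ}
    (hlim : Tendsto p atTop (𝓝 2)) (T : lp G 2 →ₗ[𝕜] lp G 2 × H)
    (hT : ∀ x, ‖x‖ ^ 2 = ‖(T x).1‖ ^ 2 + ‖(T x).2‖ ^ 2) {n : ℕ} (hn : p n < 2)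
    (h : ∀ m, p m < p n → PreservesExponent p T m) (y : G n) {m : ℕ} (hm : p m < p n) :
    (T (lp.single 2 n y)).1 m = 0 := by
  set v := (T (lp.single 2 n y)).1 with hv
  obtain ⟨f, hf, hTf⟩ := exists_preimage_lowerExponentSubmodule hlim T hT hn h
    (single_mem_lowerExponentSubmodule (𝕜 := 𝕜) hm (v m))
  have h1 := hT (lp.single 2 n y + f)
  have h2 := hT (lp.single 2 n y)
  have h3 := hT f
  rw [norm_single_add_sq, hf n le_rfl, add_zero, norm_zero, map_add, hTf, Prod.fst_add,
    Prod.snd_add, ← hv, add_zero, add_comm v, norm_single_add_sq, ← two_smul 𝕜 (v m), norm_smul,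
    RCLike.norm_ofNat] at h1
  rw [norm_single_two, ← hv] at h2
  rw [hTf, norm_single_two, norm_zero] at h3
  have : ‖v m‖ ^ 2 = 0 := by nlinarith
  exact norm_eq_zero.1 (pow_eq_zero_iff two_ne_zero |>.1 this)

theorem IsEllPair.norm_add_smul_sq {X : Type*} [NormedAddCommGroup X] [NormedSpace 𝕜 X] {c : ℝ}
    (hc : 1 ≤ c) {x y : X} (h : IsEllPair 𝕜 c x y) (t : ℝ) :
    ‖x + (t : 𝕜) • y‖ ^ 2 = (1 + |t| ^ c) ^ (2 / c) := by
  rw [← h t, rpow_two_div_rpow (norm_nonneg _) (by linarith)]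

theorem IsEllPair.norm_right_le {X : Type*} [NormedAddCommGroup X] [NormedSpace 𝕜 X] {c : ℝ}
    (hc : 1 ≤ c) {x y : X} (h : IsEllPair 𝕜 c x y) : ‖y‖ ≤ 1 := by
  have hx : ‖x‖ = 1 := by
    have := h.norm_add_smul_sq hc 0
    rw [abs_zero, Real.zero_rpow (by linarith), add_zero, Real.one_rpow, RCLike.ofReal_zero,
      zero_smul, add_zero] at this
    exact (pow_eq_one_iff_of_nonneg (norm_nonneg _) two_ne_zero).1 this
  -- Letting `t` grow gives `‖y‖ ≤ 1`; the value `3 / (‖y‖ - 1)` below already yields `3 ≤ 2`.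
  have key : ∀ t : ℝ, 0 < t → t * ‖y‖ ≤ t + 2 := by
    intro t ht
    have h1 := h.norm_add_smul_sq hc t
    rw [abs_of_pos ht] at h1
    have h2 : (1 + t ^ c) ^ (2 / c) ≤ (1 + t) ^ 2 := by
      have := rpow_add_rpow_two_div_anti zero_le_one ht.le one_pos hc
      simpa using this
    have h3 : ‖x + (t : 𝕜) • y‖ ≤ 1 + t :=
      (pow_le_pow_iff_left₀ (norm_nonneg _) (by positivity) two_ne_zero).1 (h1 ▸ h2)
    have h4 : ‖(t : 𝕜) • y‖ ≤ ‖x‖ + ‖x + (t : 𝕜) • y‖ := by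
      simpa using norm_sub_le (x + (t : 𝕜) • y) x |>.trans_eq (add_comm _ _)
    rw [norm_ofReal_smul, abs_of_pos ht] at h4
    linarith
  by_contra! hlt
  have h1 : 0 < ‖y‖ - 1 := by linarith
  have h2 := key (3 / (‖y‖ - 1)) (by positivity)
  have h3 : 3 / (‖y‖ - 1) * (‖y‖ - 1) = 3 := div_mul_cancel₀ _ h1.ne'
  linarith

theorem preservesExponent_of_isometry [∀ n, FiniteDimensional 𝕜 (G n)] {p : ℕ → ℝ}
    (hp : ∀ n, 1 ≤ p n ∧ p n < 2) (hlim : Tendsto p atTop (𝓝 2))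
    (ha : ∀ (n : ℕ) (x y : G n),
      ‖x + y‖ ^ 2 + ‖x - y‖ ^ 2 ≤ 2 * (‖x‖ ^ p n + ‖y‖ ^ p n) ^ (2 / p n))
    (hb : ∀ n : ℕ, ∃ (d : ℕ) (B : Module.Basis (Fin d) 𝕜 (G n)),
      ∀ j : Fin d, ∃ i : Fin d, IsEllPair 𝕜 (p n) (B i) (B j))
    (T : lp G 2 →ₗ[𝕜] lp G 2 × H)
    (hT : ∀ x, ‖x‖ ^ 2 = ‖(T x).1‖ ^ 2 + ‖(T x).2‖ ^ 2) (n : ℕ) : PreservesExponent p T n := by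
  -- The exponents need not be monotone in the index, so the induction counts the summands of
  -- smaller exponent, a finite number because `p n < 2`.
  induction hk : {m | p m < p n}.ncard using Nat.strong_induction_on generalizing n with
  | _ k ih =>
    have hlow : ∀ m, p m < p n → PreservesExponent p T m := fun m hm => by
      refine ih _ ?_ m rfl
      rw [← hk]
      refine Set.ncard_lt_ncard ⟨fun l hl => lt_trans hl hm, fun hsub => ?_⟩
        (finite_setOf_lt_of_tendsto hlim (hp n).2)
      exact lt_irrefl (p m) (hsub hm)
    obtain ⟨d, B, hB⟩ := hb n
    let P : Submodule 𝕜 (G n) :=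
      { carrier := {x | (∀ m, p m ≠ p n → (T (lp.single 2 n x)).1 m = 0) ∧
          (T (lp.single 2 n x)).2 = 0}
        zero_mem' := by simp
        add_mem' := by
          rintro x y ⟨hx, hx'⟩ ⟨hy, hy'⟩
          refine ⟨fun m hm => ?_, ?_⟩
          · rw [lp.single_add, map_add, Prod.fst_add, lp.coeFn_add, Pi.add_apply, hx m hm,
              hy m hm, add_zero]
          · rw [lp.single_add, map_add, Prod.snd_add, hx', hy', add_zero]
        smul_mem' := by
          rintro a x ⟨hx, hx'⟩
          refine ⟨fun m hm => ?_, ?_⟩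
          · rw [lp.single_smul, map_smul, Prod.smul_fst, lp.coeFn_smul, Pi.smul_apply, hx m hm,
              smul_zero]
          · rw [lp.single_smul, map_smul, Prod.smul_snd, hx', smul_zero] }
    have hP : P = ⊤ := by
      rw [eq_top_iff, ← B.span_eq, Submodule.span_le]
      rintro _ ⟨j, rfl⟩
      -- Only the second vector of a pair is controlled, which is why every basis vector must occur
      -- in that position.
      obtain ⟨i, hij⟩ := hB j
      refine eq_zero_of_ellPair_image (𝕜 := 𝕜) hlim ha (hp n).1 (hp n).2
        (T (lp.single 2 n (B i))).1 _ (T (lp.single 2 n (B i))).2 _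
        (fun m hm => ⟨image_single_apply_eq_zero_of_lt hlim T hT (hp n).2 hlow _ hm,
          image_single_apply_eq_zero_of_lt hlim T hT (hp n).2 hlow _ hm⟩) (fun t => ?_) ?_
      · rw [← hij.norm_add_smul_sq (hp n).1 t, ← norm_single_two (G := G), lp.single_add,
          lp.single_smul, hT (lp.single 2 n (B i) + (t : 𝕜) • lp.single 2 n (B j)), map_add,
          map_smul]
        rfl
      · rw [← hT, norm_single_two]
        exact pow_le_one₀ (norm_nonneg _) (hij.norm_right_le (hp n).1)
    intro x
    have hx : x ∈ P := hP ▸ Submodule.mem_top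
    exact hx

/-- Isometries of the `ℓ₂`-sum into its `2`-sum with a Hilbert space map onto the `ℓ₂`-sum. -/
theorem range_eq_of_isometry [∀ n, FiniteDimensional 𝕜 (G n)] {p : ℕ → ℝ}
    (hp : ∀ n, 1 ≤ p n ∧ p n < 2) (hlim : Tendsto p atTop (𝓝 2))
    (ha : ∀ (n : ℕ) (x y : G n),
      ‖x + y‖ ^ 2 + ‖x - y‖ ^ 2 ≤ 2 * (‖x‖ ^ p n + ‖y‖ ^ p n) ^ (2 / p n))
    (hb : ∀ n : ℕ, ∃ (d : ℕ) (B : Module.Basis (Fin d) 𝕜 (G n)),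
      ∀ j : Fin d, ∃ i : Fin d, IsEllPair 𝕜 (p n) (B i) (B j))
    (T : lp G 2 →ₗ[𝕜] lp G 2 × H)
    (hT : ∀ x, ‖x‖ ^ 2 = ‖(T x).1‖ ^ 2 + ‖(T x).2‖ ^ 2) :
    Set.range T = {z | z.2 = 0} := by
  have hpres := preservesExponent_of_isometry hp hlim ha hb T hT
  have : CompleteSpace (lp G 2) := complete_finiteDimensional_ellTwoSum 𝕜 G
  have hsum : ∀ x : lp G 2, Tendsto (fun s : Finset ℕ => ∑ m ∈ s, lp.single 2 m (x m)) atTop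
      (𝓝 x) := fun x => lp.hasSum_single (p := 2) ENNReal.ofNat_ne_top x
  have hT2 : ∀ x, (T x).2 = 0 := by
    have hc : Continuous (LinearMap.snd 𝕜 (lp G 2) H ∘ₗ T) :=
      AddMonoidHomClass.continuous_of_bound _ 1 fun x => by
        rw [one_mul]
        refine (pow_le_pow_iff_left₀ (norm_nonneg _) (norm_nonneg _) two_ne_zero).1 ?_
        rw [hT x]
        exact le_add_of_nonneg_left (sq_nonneg _)
    intro x
    refine tendsto_nhds_unique ((hc.tendsto x).comp (hsum x)) (tendsto_const_nhds.congr fun s => ?_)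
    rw [Function.comp_apply, map_sum]
    exact (Finset.sum_eq_zero fun m _ => (hpres m _).2).symm
  let L : lp G 2 →ₗᵢ[𝕜] lp G 2 :=
    { toLinearMap := LinearMap.fst 𝕜 (lp G 2) H ∘ₗ T
      norm_map' := fun x => by
        have := hT x
        rw [hT2, norm_zero] at this
        exact (pow_left_inj₀ (norm_nonneg _) (norm_nonneg _) two_ne_zero).1
          (by simpa using this.symm) }
  have hL : ∀ x, T x = (L x, 0) := fun x => Prod.ext rfl (hT2 x)
  have hclosed : IsClosed (Set.range L) := L.isometry.isClosedEmbedding.isClosed_range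
  ext ⟨g, h⟩
  constructor
  · rintro ⟨x, hx⟩
    exact hx ▸ hT2 x
  · intro hh
    have hh' : h = 0 := hh
    subst hh'
    suffices hg : g ∈ Set.range L by
      obtain ⟨x, hx⟩ := hg
      exact ⟨x, by rw [hL, hx]⟩
    -- The range is closed, so it suffices to reach finite partial sums. The bound `(p m + 2) / 2`
    -- is just a number strictly between `p m` and 2.
    refine hclosed.mem_of_tendsto (hsum g) (Eventually.of_forall fun s => ?_)
    change _ ∈ LinearMap.range L.toLinearMap
    refine Submodule.sum_mem _ fun m _ => ?_
    obtain ⟨f, -, hf⟩ := exists_preimage_lowerExponentSubmodule hlim T hT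
      (show (p m + 2) / 2 < 2 by linarith [(hp m).2]) (fun l _ => hpres l)
      (single_mem_lowerExponentSubmodule (𝕜 := 𝕜) (show p m < (p m + 2) / 2 by
        linarith [(hp m).2]) (g m))
    exact ⟨f, congrArg Prod.fst hf⟩

end IsometryOnto

/-! ### Density characters -/

section Density

theorem densityCharacter_le_mk {X : Type u} [TopologicalSpace X] {s : Set X} (hs : Dense s) :
    densityCharacter X ≤ #s :=
  csInf_le' ⟨s, hs, rfl⟩

theorem exists_dense_mk_eq_densityCharacter (X : Type u) [TopologicalSpace X] :
    ∃ s : Set X, Dense s ∧ #s = densityCharacter X :=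
  csInf_mem (s := {c | ∃ s : Set X, Dense s ∧ #s = c}) ⟨_, Set.univ, dense_univ, rfl⟩

/-- A dense set has at least the cardinality of any uniformly separated family. -/
theorem mk_le_mk_of_dense_of_separated {ι X : Type u} [SeminormedAddCommGroup X] (e : ι → X)
    (he : ∀ i j, i ≠ j → 1 ≤ ‖e i - e j‖) {s : Set X} (hs : Dense s) : #ι ≤ #s := by
  have h : ∀ i, ∃ y : s, ‖e i - y‖ < 1 / 2 := fun i => by
    obtain ⟨y, hy, hy'⟩ := hs.exists_dist_lt (e i) (show (0 : ℝ) < 1 / 2 by norm_num)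
    exact ⟨⟨y, hy⟩, by rwa [← dist_eq_norm]⟩
  choose f hf using h
  refine Cardinal.mk_le_of_injective (f := f) fun i j hij => ?_
  by_contra hne
  have h1 := hf i
  have h2 := hf j
  rw [← hij, norm_sub_rev] at h2
  have h3 := norm_add_le (e i - f i) (f i - e j)
  rw [sub_add_sub_cancel] at h3
  linarith [he i j hne]

/-- Finite sums of basis vectors with coefficients from a countable dense set of scalars are dense,
and are coded by lists over `ι × ℕ`. -/
theorem HilbertBasis.exists_dense_mk_le {𝕜 : Type*} [RCLike 𝕜] {ι H : Type u}
    [NormedAddCommGroup H] [InnerProductSpace 𝕜 H] (b : HilbertBasis ι 𝕜 H) :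
    ∃ t : Set H, Dense t ∧ #t ≤ max ℵ₀ #ι := by
  let d := TopologicalSpace.denseSeq 𝕜
  let S : Set H := Set.range fun q : ι × ℕ => d q.2 • b q.1
  let R : AddSubmonoid H := AddSubmonoid.closure S
  refine ⟨R, ?_, ?_⟩
  · have hb : ∀ (c : 𝕜) (i : ι), c • b i ∈ R.topologicalClosure := by
      intro c i
      have hc : c ∈ closure (Set.range d) := TopologicalSpace.denseRange_denseSeq 𝕜 c
      have := image_closure_subset_closure_image (f := fun c : 𝕜 => c • b i) (by fun_prop)
        (Set.mem_image_of_mem _ hc)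
      refine closure_mono ?_ this
      rintro _ ⟨_, ⟨n, rfl⟩, rfl⟩
      exact AddSubmonoid.subset_closure ⟨(i, n), rfl⟩
    have hspan : (Submodule.span 𝕜 (Set.range b) : Set H) ⊆ R.topologicalClosure := by
      intro x hx
      obtain ⟨c, rfl⟩ := Finsupp.mem_span_range_iff_exists_finsupp.1 hx
      exact AddSubmonoid.sum_mem _ fun i _ => hb _ i
    have hdense : Dense (Submodule.span 𝕜 (Set.range b) : Set H) := by
      rw [Submodule.dense_iff_topologicalClosure_eq_top]
      exact b.dense_span
    have := hdense.mono hspan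
    rw [AddSubmonoid.coe_topologicalClosure] at this
    exact dense_closure.1 this
  · have hsurj : (R : Set H) ⊆ Set.range fun l : List (ι × ℕ) =>
        (l.map fun q => d q.2 • b q.1).sum := by
      intro x hx
      induction hx using AddSubmonoid.closure_induction with
      | mem x hx => obtain ⟨q, rfl⟩ := hx; exact ⟨[q], by simp⟩
      | zero => exact ⟨[], rfl⟩
      | add x y _ _ hx hy =>
        obtain ⟨l, rfl⟩ := hx
        obtain ⟨m, rfl⟩ := hy
        exact ⟨l ++ m, by simp⟩
    have h1 : #(List (ι × ℕ)) ≤ max ℵ₀ #ι := by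
      refine (Cardinal.mk_list_le_max _).trans (max_le (le_max_left _ _) ?_)
      rw [Cardinal.mk_prod, Cardinal.lift_uzero, Cardinal.mk_nat, Cardinal.lift_aleph0]
      refine (Cardinal.mul_le_max _ _).trans ?_
      exact max_le (max_le (le_max_right _ _) (le_max_left _ _)) (le_max_left _ _)
    exact (Cardinal.mk_le_mk_of_subset hsurj).trans (Cardinal.mk_range_le.trans h1)

end Density

/-! ### Classification of Hilbert extensions and descent from ultrapowers -/

section Splitting

variable {𝕜 : Type*} [RCLike 𝕜] {E Y H : Type u} [NormedAddCommGroup E] [NormedSpace 𝕜 E]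
  [NormedAddCommGroup Y] [NormedSpace 𝕜 Y] [NormedAddCommGroup H] [InnerProductSpace 𝕜 H]

theorem continuous_symm_of_norm_sq_eq (Φ : Y ≃ₗ[𝕜] E × H)
    (hΦ : ∀ w, ‖w‖ ^ 2 = ‖(Φ w).1‖ ^ 2 + ‖(Φ w).2‖ ^ 2) : Continuous Φ.symm := by
  refine AddMonoidHomClass.continuous_of_bound Φ.symm 2 fun z => ?_
  refine (pow_le_pow_iff_left₀ (norm_nonneg _) (by positivity) two_ne_zero).1 ?_
  rw [hΦ, Φ.apply_symm_apply]
  have h1 := pow_le_pow_left₀ (norm_nonneg _) (norm_fst_le z) 2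
  have h2 := pow_le_pow_left₀ (norm_nonneg _) (norm_snd_le z) 2
  nlinarith

/-- In the nonseparable case, the Hilbert dimension of the Hilbert summand is the density
character. -/
theorem mk_eq_densityCharacter_of_splitting [TopologicalSpace.SeparableSpace E]
    (Φ : Y ≃ₗ[𝕜] E × H) (hΦ : ∀ w, ‖w‖ ^ 2 = ‖(Φ w).1‖ ^ 2 + ‖(Φ w).2‖ ^ 2)
    (hY : ℵ₀ < densityCharacter Y) {ι : Type u} (b : HilbertBasis ι 𝕜 H) :
    #ι = densityCharacter Y := by
  apply le_antisymm
  · obtain ⟨s, hs, hs'⟩ := exists_dense_mk_eq_densityCharacter Y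
    rw [← hs']
    -- Distinct orthonormal vectors are at distance `√2 ≥ 1`.
    refine mk_le_mk_of_dense_of_separated (fun i => Φ.symm (0, b i)) (fun i j hij => ?_) hs
    refine (one_le_sq_iff₀ (norm_nonneg _)).1 ?_
    rw [← map_sub, hΦ, Φ.apply_symm_apply, Prod.snd_sub,
      norm_sub_sq (𝕜 := 𝕜), b.orthonormal.1 i, b.orthonormal.1 j, b.orthonormal.2 hij]
    simp
  · obtain ⟨t, ht, ht'⟩ := b.exists_dense_mk_le
    obtain ⟨s, hs, hs'⟩ := TopologicalSpace.exists_countable_dense E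
    have hd : Dense (Φ.symm '' (s ×ˢ t)) :=
      Φ.symm.surjective.denseRange.dense_image (continuous_symm_of_norm_sq_eq Φ hΦ) (hs'.prod ht)
    have h1 : densityCharacter Y ≤ max ℵ₀ #ι := by
      refine (densityCharacter_le_mk hd).trans (Cardinal.mk_image_le.trans ?_)
      rw [Cardinal.mk_setProd]
      refine (Cardinal.mul_le_max _ _).trans ?_
      simp only [max_le_iff]
      exact ⟨⟨hs.le_aleph0.trans (le_max_left _ _), ht'⟩, le_max_left _ _⟩
    rcases le_max_iff.1 h1 with h | h
    · exact absurd h (not_le.2 hY)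
    · exact h

/-- Both Hilbert summands have dimension equal to the common density character; matching orthonormal
bases and fixing `E` gives the isometry. -/
theorem IsHilbertExtension.nonempty_linearIsometryEquiv [TopologicalSpace.SeparableSpace E]
    {Z : Type u} [NormedAddCommGroup Z] [NormedSpace 𝕜 Z] (hY : IsHilbertExtension 𝕜 E Y)
    (hZ : IsHilbertExtension 𝕜 E Z) (hκ : ℵ₀ < densityCharacter Y)
    (h : densityCharacter Z = densityCharacter Y) : Nonempty (Y ≃ₗᵢ[𝕜] Z) := by
  obtain ⟨H, _, _, _, Φ, hΦ⟩ := hY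
  obtain ⟨K, _, _, _, Ψ, hΨ⟩ := hZ
  obtain ⟨w, b, -⟩ := exists_hilbertBasis 𝕜 H
  obtain ⟨v, c, -⟩ := exists_hilbertBasis 𝕜 K
  have hwv : #w = #v := by
    rw [mk_eq_densityCharacter_of_splitting Φ hΦ hκ b,
      mk_eq_densityCharacter_of_splitting Ψ hΨ (h ▸ hκ) c, h]
  obtain ⟨e⟩ := Cardinal.eq.1 hwv
  have hc' : ⊤ ≤ (Submodule.span 𝕜 (Set.range (c ∘ e))).topologicalClosure := by
    rw [Set.range_comp, e.surjective.range_eq, Set.image_univ, c.dense_span]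
  let T : H ≃ₗᵢ[𝕜] K :=
    b.repr.trans (HilbertBasis.mk (c.orthonormal.comp e e.injective) hc').repr.symm
  refine ⟨⟨(Φ.trans ((LinearEquiv.refl 𝕜 E).prodCongr T.toLinearEquiv)).trans Ψ.symm,
    fun y => ?_⟩⟩
  refine (pow_left_inj₀ (norm_nonneg _) (norm_nonneg _) two_ne_zero).1 ?_
  rw [hΨ, hΦ y]
  simp

/-- A complete subspace of `E ⊕ H` containing `E` is a Hilbert extension of `E`. -/
theorem IsHilbertExtension.of_linearIsometry {Z : Type u} [NormedAddCommGroup Z]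
    [NormedSpace 𝕜 Z] [CompleteSpace Y] (Φ : Z ≃ₗ[𝕜] E × H)
    (hΦ : ∀ w, ‖w‖ ^ 2 = ‖(Φ w).1‖ ^ 2 + ‖(Φ w).2‖ ^ 2) (j : E →ₗᵢ[𝕜] Z)
    (hj : ∀ e, Φ (j e) = (e, 0)) (δ : Y →ₗᵢ[𝕜] Z) (hmem : ∀ e, j e ∈ Set.range δ) :
    IsHilbertExtension 𝕜 E Y := by
  choose s hs using hmem
  let σ : E →ₗᵢ[𝕜] Y :=
    { toFun := s
      map_add' := fun x y => δ.injective (by simp only [map_add, hs])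
      map_smul' := fun c x => δ.injective (by
        simp only [map_smul, hs, RingHom.id_apply])
      norm_map' := fun x => by
        change ‖s x‖ = _
        rw [← δ.norm_map, hs, j.norm_map] }
  have hσ : ∀ e, Φ (δ (σ e)) = (e, 0) := fun e => by
    rw [← hj e, ← hs e]; rfl
  refine IsHilbertExtension.of_retraction
    (LinearMap.fst 𝕜 E H ∘ₗ Φ.toLinearMap ∘ₗ δ.toLinearMap) σ
    (fun f => congrArg Prod.fst (hσ f)) (fun f k hk => ?_) (fun x y hx hy => ?_)
  · have hk' : (Φ (δ k)).1 = 0 := hk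
    rw [← δ.norm_map, ← δ.norm_map k, hΦ, hΦ _, map_add,
      map_add, hσ, Prod.fst_add, Prod.snd_add, hk']
    simp
  · have hx' : (Φ (δ x)).1 = 0 := hx
    have hy' : (Φ (δ y)).1 = 0 := hy
    have h1 := parallelogram_law_with_norm 𝕜 (Φ (δ x)).2 (Φ (δ y)).2
    have hn : ∀ z, ‖z‖ ^ 2 = ‖(Φ (δ z)).1‖ ^ 2 + ‖(Φ (δ z)).2‖ ^ 2 :=
      fun z => by rw [← hΦ, δ.norm_map]
    rw [hn (x + y), hn (x - y), hn x, hn y]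
    simp only [map_add, map_sub, Prod.fst_add, Prod.fst_sub, Prod.snd_add, Prod.snd_sub, hx', hy',
      add_zero, sub_zero, norm_zero]
    linarith

theorem tendsto_of_ultraMk_eq_ultraDiag {X I : Type*} [NormedAddCommGroup X] [NormedSpace 𝕜 X]
    (U : Ultrafilter I) {x : lp (fun _ : I => X) ∞} {z : X}
    (h : ultraMk 𝕜 U x = ultraDiag 𝕜 U X z) : Tendsto (fun i => x i) (U : Filter I) (𝓝 z) :=
  tendsto_iff_norm_sub_tendsto_zero.2 ((Submodule.Quotient.eq (ultraNull 𝕜 U X)).1 h)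

/-- A space whose ultrapower splits as `E ⊕ H` splits in the same way, since both natural
embeddings of the ultrapower into its ultrapower map `E` onto the same subspace. -/
theorem IsHilbertExtension.of_ultrapower
    (hU : ∀ (W : Type u) [NormedAddCommGroup W] [NormedSpace 𝕜 W] [CompleteSpace W],
      IsHilbertExtension 𝕜 E W → ∀ (I : Type u) (U : Ultrafilter I),
        IsHilbertExtension 𝕜 E (BanachUltrapower 𝕜 U W))
    (hR : ∀ (H : Type u) [NormedAddCommGroup H] [InnerProductSpace 𝕜 H] (T : E →ₗ[𝕜] E × H),
      (∀ x, ‖x‖ ^ 2 = ‖(T x).1‖ ^ 2 + ‖(T x).2‖ ^ 2) → Set.range T = {z | z.2 = 0})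
    [CompleteSpace Y] {I : Type u} (V : Ultrafilter I)
    (h : IsHilbertExtension 𝕜 E (BanachUltrapower 𝕜 V Y)) : IsHilbertExtension 𝕜 E Y := by
  obtain ⟨H₂, _, _, _, Φ₂, hΦ₂⟩ := hU _ h I V
  obtain ⟨H, _, _, _, Φ, hΦ⟩ := h
  let j : E →ₗᵢ[𝕜] BanachUltrapower 𝕜 V Y :=
    { toLinearMap := Φ.symm.toLinearMap ∘ₗ LinearMap.inl 𝕜 _ H
      norm_map' := fun f => by
        have := hΦ (Φ.symm (f, 0))
        rw [← sq_eq_sq₀ (norm_nonneg _) (norm_nonneg _)]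
        simpa using this }
  have hj : ∀ e, Φ (j e) = (e, 0) := fun e => Φ.apply_symm_apply _
  have hrange : ∀ S : BanachUltrapower 𝕜 V Y →ₗᵢ[𝕜] BanachUltrapower 𝕜 V (BanachUltrapower 𝕜 V Y),
      Set.range (Φ₂.toLinearMap ∘ₗ S.toLinearMap ∘ₗ j.toLinearMap) = {z | z.2 = 0} := fun S => by
    refine hR H₂ _ fun x => ?_
    rw [← j.norm_map x, ← S.norm_map (j x), hΦ₂]
    rfl
  have hclosed : IsClosed (Set.range (ultraDiag 𝕜 V Y)) :=
    (ultraDiag 𝕜 V Y).isometry.isClosedEmbedding.isClosed_range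
  have hmem : ∀ e, j e ∈ Set.range (ultraDiag 𝕜 V Y) := by
    intro e
    -- By rigidity both embeddings carry the copy of `E` onto the same subspace, so the diagonal
    -- class of `j e` is also the class of a family `ultraDiag (y i)`. Hence `j e` is a limit of
    -- points of the closed copy of `Y`.
    have h1 := (hrange (ultraDiag 𝕜 V _)).trans (hrange (ultraMap V (ultraDiag 𝕜 V Y))).symm
    obtain ⟨e', he'⟩ := h1 ▸ Set.mem_range_self e
    have h2 : ultraMap V (ultraDiag 𝕜 V Y) (j e') = ultraDiag 𝕜 V _ (j e) := Φ₂.injective he'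
    obtain ⟨y, hy⟩ := ultraMk_surjective V (j e')
    rw [← hy, ultraMap_ultraMk] at h2
    exact hclosed.mem_of_tendsto (tendsto_of_ultraMk_eq_ultraDiag V h2)
      (Eventually.of_forall fun i => Set.mem_range_self _)
  exact IsHilbertExtension.of_linearIsometry Φ hΦ j hj (ultraDiag 𝕜 V Y) hmem

end Splitting

/-! ### Separated sequences and nonseparable ultrapowers -/

section Nonseparable

variable {𝕜 : Type*} [RCLike 𝕜] {X : Type*} [NormedAddCommGroup X] [NormedSpace 𝕜 X]

/-- Pigeonhole: an open ball of radius `1 / 2` contains at most one term of the sequence `e`. -/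
theorem exists_forall_le_norm_sub {e : ℕ → X} (he : ∀ m n, m ≠ n → 1 ≤ ‖e m - e n‖) (x : ℕ → X)
    (i : ℕ) : ∃ m, ∀ k ≤ i, 1 / 2 ≤ ‖e m - x k‖ := by
  by_contra! h
  choose k hk hlt using h
  obtain ⟨m, n, hmn, heq⟩ := Finite.exists_ne_map_eq_of_infinite
    (fun m => (⟨k m, Nat.lt_succ_of_le (hk m)⟩ : Fin (i + 1)))
  have hkk : k m = k n := congrArg Fin.val heq
  have h1 := hlt m
  have h2 := hlt n
  rw [← hkk, norm_sub_rev] at h2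
  have h3 := norm_add_le (e m - x (k m)) (x (k m) - e n)
  rw [sub_add_sub_cancel] at h3
  linarith [he m n hmn]

/-- Diagonal argument: at index `i`, choose a term of `e` far from the `i`-th entries of the first
`i + 1` members of a supposed countable dense set. The resulting class stays `1 / 2` away from every
member. -/
theorem aleph0_lt_densityCharacter_ultrapower {X : Type u} [NormedAddCommGroup X]
    [NormedSpace 𝕜 X] {e : ℕ → X} (hb : ∀ n, ‖e n‖ ≤ 1)
    (he : ∀ m n, m ≠ n → 1 ≤ ‖e m - e n‖) :
    ℵ₀ < densityCharacter (BanachUltrapower 𝕜 (hyperfilter (ULift.{u} ℕ)) X) := by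
  obtain ⟨s, hs, hs'⟩ := exists_dense_mk_eq_densityCharacter
    (BanachUltrapower 𝕜 (hyperfilter (ULift.{u} ℕ)) X)
  rw [← hs']
  by_contra! hle
  obtain ⟨d, hd⟩ := (Cardinal.le_aleph0_iff_set_countable.1 hle).exists_eq_range hs.nonempty
  choose x hx using fun k => ultraMk_surjective (hyperfilter (ULift.{u} ℕ)) (d k)
  choose m hm using fun i : ULift.{u} ℕ => exists_forall_le_norm_sub he (fun k => x k i) i.down
  let z : lp (fun _ : ULift.{u} ℕ => X) ∞ := boundedFamily (fun i => e (m i)) 1 fun i => hb _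
  obtain ⟨_, hy, hdist⟩ := hs.exists_dist_lt (ultraMk 𝕜 (hyperfilter (ULift.{u} ℕ)) z)
    (show (0 : ℝ) < 1 / 2 by norm_num)
  rw [hd] at hy
  obtain ⟨k, rfl⟩ := hy
  rw [dist_eq_norm, ← hx k] at hdist
  have h1 := tendsto_norm_ultraMk (𝕜 := 𝕜) (hyperfilter (ULift.{u} ℕ)) (z - x k)
  have hev : ∀ᶠ i in (hyperfilter (ULift.{u} ℕ) : Filter (ULift.{u} ℕ)), k ≤ i.down := by
    refine hyperfilter_le_cofinite ?_
    have : {i : ULift.{u} ℕ | ¬ k ≤ i.down}.Finite := by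
      refine ((Set.finite_lt_nat k).preimage ULift.down_injective.injOn).subset fun i hi => ?_
      exact not_le.1 hi
    exact this
  have h2 : 1 / 2 ≤ ‖ultraMk 𝕜 (hyperfilter (ULift.{u} ℕ)) (z - x k)‖ :=
    ge_of_tendsto h1 (hev.mono fun i hi => hm i k hi)
  exact absurd hdist (not_lt.2 h2)

theorem separableSpace_ellTwoSum (𝕜 : Type*) [RCLike 𝕜] (G : ℕ → Type u)
    [∀ n, NormedAddCommGroup (G n)] [∀ n, NormedSpace 𝕜 (G n)]
    [∀ n, FiniteDimensional 𝕜 (G n)] : TopologicalSpace.SeparableSpace (lp G 2) := by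
  have : ∀ n, ProperSpace (G n) := fun n => FiniteDimensional.proper_rclike 𝕜 (G n)
  have h1 : TopologicalSpace.IsSeparable
      (⋃ n, Set.range (lp.single 2 n : G n → lp G 2)) :=
    .iUnion fun n => TopologicalSpace.isSeparable_range (lp.isometry_single n).continuous
  have h2 := (h1.span (R := 𝕜)).closure
  rw [← TopologicalSpace.isSeparable_univ_iff]
  refine h2.mono fun f _ => ?_
  refine mem_closure_of_tendsto (lp.hasSum_single (p := 2) ENNReal.ofNat_ne_top f)
    (Eventually.of_forall fun s => ?_)
  exact Submodule.sum_mem _ fun m _ => Submodule.subset_span (Set.mem_iUnion.2 ⟨m, _, rfl⟩)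

theorem exists_separated_sequence_ellTwoSum (𝕜 : Type*) [RCLike 𝕜] (G : ℕ → Type u)
    [∀ n, NormedAddCommGroup (G n)] [∀ n, NormedSpace 𝕜 (G n)]
    (hG : {n : ℕ | Nontrivial (G n)}.Infinite) :
    ∃ e : ℕ → lp G 2, (∀ n, ‖e n‖ ≤ 1) ∧ ∀ m n, m ≠ n → 1 ≤ ‖e m - e n‖ := by
  let φ := hG.natEmbedding
  have hx : ∀ n, ∃ x : G (φ n), ‖x‖ = 1 := fun n => by
    have : Nontrivial (G (φ n)) := (φ n).2
    obtain ⟨x, hx⟩ := exists_ne (0 : G (φ n))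
    exact ⟨_, norm_smul_inv_norm (𝕜 := 𝕜) hx⟩
  choose x hx using hx
  refine ⟨fun n => lp.single 2 (φ n) (x n), fun n => ?_, fun m n hmn => ?_⟩
  · rw [lp.norm_single (by simp), hx]
  · refine le_trans ?_ (norm_apply_le_norm_two _ (φ m))
    rw [lp.coeFn_sub, Pi.sub_apply, lp.single_apply_self, lp.single_apply_ne, sub_zero, hx]
    exact fun h => hmn (φ.injective (Subtype.ext h))

theorem not_finiteDimensional_of_separated {e : ℕ → X} (hb : ∀ n, ‖e n‖ ≤ 1)
    (he : ∀ m n, m ≠ n → 1 ≤ ‖e m - e n‖) : ¬ FiniteDimensional 𝕜 X := by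
  intro h
  have : ProperSpace X := FiniteDimensional.proper_rclike 𝕜 X
  obtain ⟨a, -, φ, hφ, ha⟩ := (isCompact_closedBall (0 : X) 1).tendsto_subseq
    (x := e) (fun n => by simpa using hb n)
  obtain ⟨N, hN⟩ := Metric.cauchySeq_iff'.1 ha.cauchySeq 1 one_pos
  have h1 := hN (N + 1) (Nat.le_succ N)
  rw [dist_eq_norm] at h1
  exact absurd h1 (not_lt.2 (he _ _ (hφ.injective.ne (Nat.succ_ne_self N))))

end Nonseparable

/-! ### The modular given by the squared norm -/

section Criterion

variable {𝕜 : Type*} [RCLike 𝕜]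

theorem luxemburgNorm_eq_of_forall {X : Type*} [AddCommGroup X] [Module 𝕜 X] {Θ : X → ℝ} {x : X}
    {N : ℝ} (hN : 0 ≤ N) (h : ∀ t : ℝ, 0 < t → Θ ((t : 𝕜)⁻¹ • x) = (t⁻¹ * N) ^ 2) :
    luxemburgNorm 𝕜 Θ x = N := by
  have hset : {t : ℝ | 0 < t ∧ Θ (((t : 𝕜)⁻¹) • x) ≤ 1} = {t : ℝ | 0 < t ∧ N ≤ t} := by
    ext t
    refine and_congr_right fun ht => ?_
    rw [h t ht, sq_le_one_iff₀ (by positivity), inv_mul_le_iff₀ ht, mul_one]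
  rw [luxemburgNorm, hset]
  refine le_antisymm (le_of_forall_pos_le_add fun ε hε => ?_) ?_
  · exact csInf_le ⟨0, fun t ht => ht.1.le⟩ ⟨by linarith, by linarith⟩
  · exact le_csInf ⟨N + 1, by linarith, by linarith⟩ fun t ht => ht.2

theorem norm_ofReal_inv_smul {V : Type*} [NormedAddCommGroup V] [NormedSpace 𝕜 V] {t : ℝ}
    (ht : 0 < t) (v : V) : ‖(t : 𝕜)⁻¹ • v‖ = t⁻¹ * ‖v‖ := by
  rw [← RCLike.ofReal_inv, norm_ofReal_smul, abs_of_pos (inv_pos.2 ht)]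

theorem luxemburgNorm_norm_sq {X : Type*} [NormedAddCommGroup X] [NormedSpace 𝕜 X] (x : X) :
    luxemburgNorm 𝕜 (fun x : X => ‖x‖ ^ 2) x = ‖x‖ :=
  luxemburgNorm_eq_of_forall (norm_nonneg x) fun t ht => by rw [norm_ofReal_inv_smul ht]

theorem luxemburgNorm_modularSum {X H : Type*} [NormedAddCommGroup X] [NormedSpace 𝕜 X]
    [NormedAddCommGroup H] [NormedSpace 𝕜 H] (z : X × H) :
    luxemburgNorm 𝕜 (modularSum fun x : X => ‖x‖ ^ 2) z = √(‖z.1‖ ^ 2 + ‖z.2‖ ^ 2) := by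
  refine luxemburgNorm_eq_of_forall (Real.sqrt_nonneg _) fun t ht => ?_
  rw [mul_pow, Real.sq_sqrt (by positivity), modularSum, Prod.smul_fst, Prod.smul_snd,
    norm_ofReal_inv_smul ht, norm_ofReal_inv_smul ht]
  ring

theorem isConvexModular_norm_sq (𝕜 : Type*) [RCLike 𝕜] (X : Type*) [NormedAddCommGroup X]
    [NormedSpace 𝕜 X] : IsConvexModular 𝕜 fun x : X => ‖x‖ ^ 2 where
  nonneg x := sq_nonneg _
  convex x y a b ha hb hab := by
    have h1 : ‖(a : 𝕜) • x + (b : 𝕜) • y‖ ≤ a * ‖x‖ + b * ‖y‖ := by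
      refine (norm_add_le _ _).trans_eq ?_
      rw [norm_ofReal_smul, norm_ofReal_smul, abs_of_nonneg ha, abs_of_nonneg hb]
    refine (pow_le_pow_left₀ (norm_nonneg _) h1 2).trans ?_
    obtain rfl : b = 1 - a := by linarith
    -- The convexity gap is exactly `a * b * (‖x‖ - ‖y‖) ^ 2`.
    nlinarith [mul_nonneg (mul_nonneg ha hb) (sq_nonneg (‖x‖ - ‖y‖))]
  map_zero := by simp
  symmetric c x hc := by rw [norm_smul, hc, one_mul]
  faithful x hx := norm_eq_zero.1 (pow_eq_zero_iff two_ne_zero |>.1 hx)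

end Criterion

/-! ### Categoricity from stability and rigidity -/

/-- The cardinal `κ` is the density character of a nonprincipal countable ultrapower of `E`, which
is then itself the required model. Stability is assumed for all complete Hilbert extensions, since
the descent to `Y` uses an ultrapower of an ultrapower. -/
theorem uncountablyCategorical_of_isHilbertExtension_ultrapower {𝕜 : Type*} [RCLike 𝕜] {E : Type u}
    [NormedAddCommGroup E] [NormedSpace 𝕜 E] [CompleteSpace E]
    [TopologicalSpace.SeparableSpace E]
    (hU : ∀ (W : Type u) [NormedAddCommGroup W] [NormedSpace 𝕜 W] [CompleteSpace W],
      IsHilbertExtension 𝕜 E W → ∀ (I : Type u) (U : Ultrafilter I),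
        IsHilbertExtension 𝕜 E (BanachUltrapower 𝕜 U W))
    (hR : ∀ (H : Type u) [NormedAddCommGroup H] [InnerProductSpace 𝕜 H] (T : E →ₗ[𝕜] E × H),
      (∀ x, ‖x‖ ^ 2 = ‖(T x).1‖ ^ 2 + ‖(T x).2‖ ^ 2) → Set.range T = {z | z.2 = 0})
    {e : ℕ → E} (hb : ∀ n, ‖e n‖ ≤ 1) (he : ∀ m n, m ≠ n → 1 ≤ ‖e m - e n‖) :
    UncountablyCategorical 𝕜 E := by
  have hκ := aleph0_lt_densityCharacter_ultrapower (𝕜 := 𝕜) hb he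
  refine ⟨not_finiteDimensional_of_separated hb he, inferInstance, _, hκ, ?_, ?_⟩
  · refine ⟨BanachUltrapower 𝕜 (hyperfilter (ULift.{u} ℕ)) E, inferInstance, inferInstance,
      inferInstance, ?_, rfl⟩
    exact ⟨ULift.{u} ℕ, PUnit, hyperfilter (ULift.{u} ℕ), pure PUnit.unit,
      ⟨LinearIsometryEquiv.ofSurjective (ultraDiag 𝕜 (pure PUnit.unit)
        (BanachUltrapower 𝕜 (hyperfilter (ULift.{u} ℕ)) E)) (ultraDiag_surjective_of_pure _)⟩⟩
  · have hsplit : ∀ (Y : Type u) [NormedAddCommGroup Y] [NormedSpace 𝕜 Y] [CompleteSpace Y],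
        ElementarilyEquivalent 𝕜 E Y → IsHilbertExtension 𝕜 E Y := by
      intro Y _ _ _ h
      obtain ⟨I, J, U, V, ⟨ψ⟩⟩ := h
      exact .of_ultrapower hU hR V ((hU E (.refl 𝕜 E) I U).congr ψ)
    intro Y Z _ _ _ _ _ _ hY hYκ hZ hZκ
    exact (hsplit Y hY).nonempty_linearIsometryEquiv (hsplit Z hZ) (hYκ ▸ hκ) (hZκ.trans hYκ.symm)

end

theorem proposition5p5 {𝕜 : Type*} [RCLike 𝕜] (E : ℕ → Type u)
    [∀ n, NormedAddCommGroup (E n)] [∀ n, NormedSpace 𝕜 (E n)]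
    [∀ n, FiniteDimensional 𝕜 (E n)]
    (hE : {n : ℕ | Nontrivial (E n)}.Infinite)
    (p : ℕ → ℝ) (hp : ∀ n, 1 ≤ p n ∧ p n < 2) (hlim : Tendsto p atTop (𝓝 2))
    (ha : ∀ (n : ℕ) (x y : E n),
      ‖x + y‖ ^ 2 + ‖x - y‖ ^ 2 ≤ 2 * (‖x‖ ^ p n + ‖y‖ ^ p n) ^ (2 / p n))
    (hb : ∀ n : ℕ, ∃ (d : ℕ) (B : Module.Basis (Fin d) 𝕜 (E n)),
      ∀ j : Fin d, ∃ i : Fin d, IsEllPair 𝕜 (p n) (B i) (B j)) :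
    CategoricityCriterion 𝕜 (lp E 2) (fun x => ‖x‖ ^ 2) ∧
      UncountablyCategorical 𝕜 (lp E 2) := by
  have hcomplete : CompleteSpace (lp E 2) := complete_finiteDimensional_ellTwoSum 𝕜 E
  have hsep : TopologicalSpace.SeparableSpace (lp E 2) := separableSpace_ellTwoSum 𝕜 E
  obtain ⟨e, he1, he⟩ := exists_separated_sequence_ellTwoSum 𝕜 E hE
  have hU : ∀ (W : Type u) [NormedAddCommGroup W] [NormedSpace 𝕜 W] [CompleteSpace W],
      IsHilbertExtension 𝕜 (lp E 2) W → ∀ (I : Type u) (U : Ultrafilter I),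
        IsHilbertExtension 𝕜 (lp E 2) (BanachUltrapower 𝕜 U W) :=
    fun W _ _ _ hW I U => hW.ultrapower hp hlim ha U
  refine ⟨⟨isConvexModular_norm_sq 𝕜 _, fun x => (luxemburgNorm_norm_sq x).symm,
    ⟨4, fun x => ?_⟩, hcomplete, not_finiteDimensional_of_separated he1 he, ?_, ?_⟩,
    uncountablyCategorical_of_isHilbertExtension_ultrapower hU
      (fun H _ _ T => range_eq_of_isometry hp hlim ha hb T) he1 he⟩
  · change ‖(2 : 𝕜) • x‖ ^ 2 ≤ 4 * ‖x‖ ^ 2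
    rw [norm_smul, RCLike.norm_ofNat]
    exact le_of_eq (by ring)
  · intro I U
    obtain ⟨H, _, _, hH, Φ, hΦ⟩ := hU _ (.refl 𝕜 (lp E 2)) I U
    refine ⟨H, _, _, hH, Φ, fun x => ?_⟩
    have h := (tendsto_norm_ultraMk (𝕜 := 𝕜) U x).pow 2
    rw [hΦ] at h
    exact h
  · intro H _ _ _ T hT
    refine range_eq_of_isometry hp hlim ha hb T fun x => ?_
    rw [← hT x, luxemburgNorm_modularSum, Real.sq_sqrt (by positivity)]
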